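/- Let $n\geqslant 2$, $p>n-1$, let $D\subset\mathbb R^n$ be a domain (non-empty, open, connected), and let $f:D\to\mathbb R^n$ be a continuous mapping that is differentiable almost everywhere in $D$ and has the Luzin $N$-property: $m(f(A))=0$ for every $A\subset D$ with $m(A)=0$, where $m$ is Lebesgue measure. Suppose that $$N(f,D):=\sup_{y\in\mathbb R^n}{\rm card}\,\{x\in D: f(x)=y\}<\infty$$ and that $m\big(f(\{x\in D: J(x,f)=0\})\big)=0$, where $J(x,f)=\det f'(x)$ is considered at the points of differentiability of $f$. Let $y_0\in\mathbb R^n$ belong to $\overline{f(D)}$, let $r_0=\sup_{y\in f(D)}|y-y_0|\in(0,\infty]$ and $0<\varepsilon<r_0$. Write $S(y_0,r)=\{y:|y-y_0|=r\}$ and $A(y_0,\varepsilon,r_0)=\{y:\varepsilon<|y-y_0|<r_0\}$, and let $\mathcal H^{n-1}$ be the $(n-1)$-dimensional Hausdorff measure. Suppose that for almost all $r\in(\varepsilon,r_0)$ the mapping $f$ has the $N^{-1}$-property on $S(y_0,r)\cap f(D)$ with respect to $\mathcal H^{n-1}$: if $A\subset S(y_0,r)\cap f(D)$ and $\mathcal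 H^{n-1}(A)=0$, then $\mathcal H^{n-1}(f^{-1}(A))=0$. Let $\Sigma_\varepsilon$ be the family of all sets $f^{-1}(S(y_0,r)\cap f(D))$, $r\in(\varepsilon,r_0)$, and let $f(\Sigma_\varepsilon)=\{f(\sigma):\sigma\in\Sigma_\varepsilon\}$. For $q>0$ put $$\widetilde M_q(\Sigma_\varepsilon)=\inf_\rho\int_{\mathbb R^n}\rho^{q}\,dm,$$ the infimum being over all Borel $\rho:\mathbb R^n\to[0,\infty]$ with $\int_\sigma\rho\,d\mathcal H^{n-1}\geqslant1$ for every $\sigma\in\Sigma_\varepsilon$. For a family $\Gamma$ of subsets of $\mathbb R^n$ (surfaces) put $M_p(\Gamma)=\inf_\rho\int_{\mathbb R^n}\rho^p\,dm$, the infimum being over all Borel $\rho:\mathbb R^n\to[0,\infty]$ with $\int_S\rho^{n-1}\,d\mathcal H^{n-1}\geqslant 1$ for every $S\in\Gamma$. Let ${\rm ext\,adm}_p\,\Gamma$ be the set of all Lebesgue measurable $\rho:\mathbb R^n\to[0,\infty]$ such that, for all $S\in\Gamma$ outside a subfamily of zero $p$-modulus $M_p$, $\rho$ is $\mathcal H^{n-1}$-measurable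 on $S$ and $\int_S\rho^{n-1}\,d\mathcal H^{n-1}\geqslant1$. For $\alpha=\frac{p}{p-n+1}$ put $$Q(y)=K_{I,\alpha}(y,f^{-1})=\sum_{x\in f^{-1}(y)}K_{O,\alpha}(x,f),$$ where, at a point $x$ of differentiability of $f$, $K_{O,\alpha}(x,f)=\|f'(x)\|^\alpha/|J(x,f)|$ if $J(x,f)\ne0$, $K_{O,\alpha}(x,f)=1$ if $f'(x)=0$, and $K_{O,\alpha}(x,f)=\infty$ otherwise; here $\|f'(x)\|$ is the operator norm (so $Q$ is defined at almost every point of $f(D)$). Then $$\widetilde M_{\frac{p}{n-1}}(\Sigma_\varepsilon)\;\geqslant\;\frac{1}{N^{\frac{p}{n-1}}(f,D)}\;\inf_{\rho\in{\rm ext\,adm}_p\,f(\Sigma_\varepsilon)}\;\int_{f(D)\cap A(y_0,\varepsilon,r_0)}\frac{\rho^p(y)}{Q^{\frac{p-n+1}{n-1}}(y)}\,dm(y).$$ -/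

import Mathlib

open MeasureTheory Set
open scoped ENNReal

noncomputable section

namespace InverseKI

/-- Euclidean space `ℝⁿ`. -/
abbrev E (n : ℕ) : Type := EuclideanSpace ℝ (Fin n)

/-- The outer dilatation `K_{O,α}(x, f)` of order `α` at a point `x` of differentiability of `f`:
`‖f'(x)‖ ^ α / |J(x, f)|` if `J(x, f) ≠ 0`, `1` if `f'(x) = 0`, and `∞` otherwise.
(At points where `f` is not differentiable the value is irrelevant.) -/
def outerDilatation {n : ℕ} (α : ℝ) (f : E n → E n) (x : E n) : ℝ≥0∞ :=
  open Classical in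
  if (fderiv ℝ f x).det ≠ 0 then
    ENNReal.ofReal (‖fderiv ℝ f x‖ ^ α / |(fderiv ℝ f x).det|)
  else if fderiv ℝ f x = 0 then 1
  else ⊤

/-- `K_{I,α}(y, f⁻¹) = ∑_{x ∈ f⁻¹(y)} K_{O,α}(x, f)`, for a mapping `f` of `D`. -/
def innerDilatationInv {n : ℕ} (α : ℝ) (f : E n → E n) (D : Set (E n)) (y : E n) : ℝ≥0∞ :=
  ∑' x : {x : E n // x ∈ D ∧ f x = y}, outerDilatation α f x

/-- The maximal multiplicity `N(f, D) = sup_y card {x ∈ D : f x = y}`. -/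
def multiplicity {n : ℕ} (f : E n → E n) (D : Set (E n)) : ℕ∞ :=
  ⨆ y : E n, {x : E n | x ∈ D ∧ f x = y}.encard

/-- The Luzin `N`-property of `f` on `D` with respect to Lebesgue measure. -/
def LuzinN {n : ℕ} (f : E n → E n) (D : Set (E n)) : Prop :=
  ∀ A : Set (E n), A ⊆ D → volume A = 0 → volume (f '' A) = 0

/-- The `N⁻¹`-property of `f : D → ℝⁿ` on a set `T ⊆ f(D)` with respect to the
`(n-1)`-dimensional Hausdorff measure. -/
def LuzinNInvOn {n : ℕ} (f : E n → E n) (D T : Set (E n)) : Prop :=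
  ∀ A : Set (E n), A ⊆ T → μHE[n - 1] A = 0 → μHE[n - 1] (D ∩ f ⁻¹' A) = 0

/-- Admissible functions for a family `Σ` of sets, in the sense of moduli of separating sets:
Borel `ρ : ℝⁿ → [0, ∞]` with `∫_σ ρ dℋⁿ⁻¹ ≥ 1` for all `σ ∈ Σ`. -/
def sepAdm {n : ℕ} (S : Set (Set (E n))) : Set (E n → ℝ≥0∞) :=
  {ρ | Measurable ρ ∧ ∀ σ ∈ S, 1 ≤ ∫⁻ x in σ, ρ x ∂(μHE[n - 1])}

/-- The modulus of order `q` of a family of separating sets. -/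
def sepModulus {n : ℕ} (q : ℝ) (S : Set (Set (E n))) : ℝ≥0∞ :=
  ⨅ ρ ∈ sepAdm S, ∫⁻ x, ρ x ^ q

/-- Admissible functions for a family of surfaces (each of multiplicity one, hence given by a
set): Borel `ρ : ℝⁿ → [0, ∞]` with `∫_S ρⁿ⁻¹ dℋⁿ⁻¹ ≥ 1` for all `S` in the family. -/
def surfAdm {n : ℕ} (Γ : Set (Set (E n))) : Set (E n → ℝ≥0∞) :=
  {ρ | Measurable ρ ∧ ∀ S ∈ Γ, 1 ≤ ∫⁻ y in S, ρ y ^ (n - 1) ∂(μHE[n - 1])}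

/-- The `p`-modulus `M_p(Γ)` of a family of surfaces. -/
def surfModulus {n : ℕ} (p : ℝ) (Γ : Set (Set (E n))) : ℝ≥0∞ :=
  ⨅ ρ ∈ surfAdm Γ, ∫⁻ y, ρ y ^ p

/-- A property holds for `p`-almost all surfaces of `Γ` if the subfamily where it fails has zero
`p`-modulus. -/
def AlmostAllSurf {n : ℕ} (p : ℝ) (Γ : Set (Set (E n))) (P : Set (E n) → Prop) : Prop :=
  surfModulus p {S | S ∈ Γ ∧ ¬ P S} = 0

/-- `p`-extensively admissible functions for `Γ`: Lebesgue measurable `ρ : ℝⁿ → [0, ∞]` such that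
for `p`-almost all `S ∈ Γ` the integral `∫_S ρⁿ⁻¹ dℋⁿ⁻¹` makes sense and is at least `1`. -/
def extAdm {n : ℕ} (p : ℝ) (Γ : Set (Set (E n))) : Set (E n → ℝ≥0∞) :=
  {ρ | AEMeasurable ρ volume ∧ AlmostAllSurf p Γ fun S =>
    AEMeasurable ρ ((μHE[n - 1] : Measure (E n)).restrict S) ∧
      1 ≤ ∫⁻ y in S, ρ y ^ (n - 1) ∂(μHE[n - 1])}

/-- `r₀ = sup_{y ∈ f(D)} |y - y₀| ∈ [0, ∞]`. -/
def outerRadius {n : ℕ} (f : E n → E n) (D : Set (E n)) (y₀ : E n) : ℝ≥0∞ :=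
  ⨆ y ∈ f '' D, edist y y₀

/-- The family `Σ_ε` of all preimages `f⁻¹(S(y₀, r) ∩ f(D))`, `r ∈ (ε, r₀)`. -/
def spherePreimages {n : ℕ} (f : E n → E n) (D : Set (E n)) (y₀ : E n) (ε : ℝ) :
    Set (Set (E n)) :=
  {σ | ∃ r : ℝ, ε < r ∧ ENNReal.ofReal r < outerRadius f D y₀ ∧
    σ = D ∩ f ⁻¹' (Metric.sphere y₀ r ∩ f '' D)}

/-- The spherical ring `A(y₀, r₁, r₂) = {y : r₁ < |y - y₀| < r₂}`, where `r₂ = ∞` is allowed. -/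
def ring {n : ℕ} (y₀ : E n) (r₁ : ℝ) (r₂ : ℝ≥0∞) : Set (E n) :=
  {y | ENNReal.ofReal r₁ < edist y y₀ ∧ edist y y₀ < r₂}

end InverseKI

end

/-! ### Zeros of coercive vector fields -/

namespace InverseKI

/-! Put m = n - 1, q = p/m, and let ρ be admissible for the preimages of spheres. Transport it by
R(y) = ∑ ρ(x) ‖f'(x)‖ / |J(x,f)|, summed over the regular points x of the fibre of y, and let ρ' =
R^(1/m). Near a regular point the preimage of a piece of a sphere has area at most about ‖f'‖/|J|
times that of the piece, so R has integral at least 1 over almost every S(y₀,r) ∩ f(D). Hölder's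
inequality on the fibre gives R^q ≤ (∑ ρ^q/|J|) · Q^(q/α), and by change of variables the sum
integrates to at most ∫ ρ^q. To make this rigorous, f' is frozen on countably many pieces where f is
injective and nearly linear (`exists_regular_pieces`), at the cost of a factor τ > 1 that finally
tends to 1.

The points outside the pieces have a null image. Almost every sphere meets this image in an ℋ^m-null
set (`ae_euclideanHausdorffMeasure_slice_eq_zero`), whose preimage is negligible by the
N⁻¹-property. The remaining radii form a null set. The corresponding surfaces have zero p-modulus
provided each has positive area, because a function equal to ∞ on the exceptional spheres is then
admissible.

Positivity of area is topological (`sphere_inter_image_ne_zero`). The zero set of |f - y₀| - r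
separates D, and f is finite-to-one on it. If its image were ℋ^m-null, the transverse coordinates on
it could be perturbed to omit a value (`exists_approx_null_range`), against the Poincaré–Miranda
theorem. The latter rests on the absence of Lipschitz retractions of a ball onto its boundary, which
a volume computation with a polynomial in t shows. -/

open Polynomial in
theorem exists_polynomial_det_one_add_smul {V : Type*} [NormedAddCommGroup V] [NormedSpace ℝ V]
    [FiniteDimensional ℝ V] (A : V →L[ℝ] V) :
    ∃ P : ℝ[X], P.natDegree ≤ Module.finrank ℝ V ∧
      ∀ t : ℝ, P.eval t = ((1 : V →L[ℝ] V) + t • A).det := by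
  let b := Module.finBasis ℝ V
  let M := LinearMap.toMatrix b b A.toLinearMap
  refine ⟨((X : ℝ[X]) • M.map C + (1 : Matrix _ _ ℝ).map C).det, ?_, fun t => ?_⟩
  · simpa using natDegree_det_X_add_C_le M 1
  · rw [← Polynomial.coe_evalRingHom, RingHom.map_det, ContinuousLinearMap.det,
      ← LinearMap.det_toMatrix b]
    congr 1
    have h1 : LinearMap.toMatrix b b ((1 : V →L[ℝ] V) + t • A).toLinearMap = 1 + t • M := by
      rw [ContinuousLinearMap.toLinearMap_add, ContinuousLinearMap.toLinearMap_smul, map_add,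
        map_smul]
      congr 1
      exact LinearMap.toMatrix_one b
    rw [h1]
    ext i j
    by_cases hij : i = j <;> simp [hij] <;> ring

/-- Lagrange interpolation of a polynomial in t. The nodes and weights do not depend on `A`, so an
integral identity known only for small t carries over to t = 1. -/
theorem det_one_add_eq_sum {V : Type*} [NormedAddCommGroup V] [NormedSpace ℝ V]
    [FiniteDimensional ℝ V] (A : V →L[ℝ] V) {v : ℕ → ℝ} (hv : Function.Injective v) :
    ((1 : V →L[ℝ] V) + A).det = ∑ i ∈ Finset.range (Module.finrank ℝ V + 1),
      ((1 : V →L[ℝ] V) + v i • A).det *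
        (Lagrange.basis (Finset.range (Module.finrank ℝ V + 1)) v i).eval 1 := by
  obtain ⟨P, hP, hPe⟩ := exists_polynomial_det_one_add_smul A
  have hdeg : P.degree < (Finset.range (Module.finrank ℝ V + 1)).card := by
    rw [Finset.card_range]
    exact lt_of_le_of_lt Polynomial.degree_le_natDegree (by exact_mod_cast Nat.lt_succ_of_le hP)
  have h := congrArg (Polynomial.eval 1) (Lagrange.eq_interpolate hv.injOn hdeg)
  rw [hPe 1, one_smul] at h
  rw [h, Lagrange.interpolate_apply, Polynomial.eval_finsetSum]
  simp [hPe]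

theorem sum_eval_lagrange_basis (N : ℕ) {v : ℕ → ℝ} (hv : Function.Injective v) :
    ∑ i ∈ Finset.range (N + 1), (Lagrange.basis (Finset.range (N + 1)) v i).eval 1 = 1 := by
  rw [← Polynomial.eval_finsetSum, Lagrange.sum_basis hv.injOn (by simp), Polynomial.eval_one]

/-! ### No Lipschitz retraction of a ball onto its boundary sphere, and zeros of vector fields -/

section Retraction

variable {V : Type*} [NormedAddCommGroup V] [InnerProductSpace ℝ V] [FiniteDimensional ℝ V]

/-- A map of the form `id + t h`, with `h` Lipschitz and supported in a ball, permutes the ball when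
`t` is small. -/
theorem image_ball_of_lipschitz_perturbation [Nontrivial V] {R : ℝ} {h : V → V} {K : NNReal}
    (hh : LipschitzWith K h) (hout : ∀ x, R ≤ ‖x‖ → h x = 0) {t : NNReal} (ht : t * K < 1) :
    InjOn (fun x => x + (t : ℝ) • h x) (Metric.ball 0 R) ∧
      (fun x => x + (t : ℝ) • h x) '' Metric.ball 0 R = Metric.ball 0 R := by
  set F : V → V := fun x => x + (t : ℝ) • h x with hF
  have happ : ApproximatesLinearOn F
      ((ContinuousLinearEquiv.refl ℝ V : V ≃L[ℝ] V) : V →L[ℝ] V) univ (t * K) := by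
    intro x _ y _
    have : F x - F y - ((ContinuousLinearEquiv.refl ℝ V : V ≃L[ℝ] V) : V →L[ℝ] V) (x - y)
        = (t : ℝ) • (h x - h y) := by
      simp [hF, smul_sub]; abel
    rw [this, norm_smul]
    have := hh.dist_le_mul x y
    rw [dist_eq_norm, dist_eq_norm] at this
    simp only [Real.norm_eq_abs, NNReal.abs_eq, NNReal.coe_mul]
    nlinarith [t.coe_nonneg]
  have hc : Subsingleton V ∨ t * K < ‖((ContinuousLinearEquiv.refl ℝ V).symm : V →L[ℝ] V)‖₊⁻¹ := by
    right
    have : ‖((ContinuousLinearEquiv.refl ℝ V).symm : V →L[ℝ] V)‖₊ = 1 := by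
      have := ContinuousLinearMap.nnnorm_id (𝕜 := ℝ) (E := V)
      exact this
    rw [this]; simpa using ht
  have : CompleteSpace V := FiniteDimensional.complete ℝ V
  let e := happ.toHomeomorph F hc
  have he : ∀ x, e x = F x := fun x => rfl
  have hinj : Function.Injective F := e.injective
  have hfix : ∀ x, R ≤ ‖x‖ → F x = x := fun x hx => by simp [hF, hout x hx]
  refine ⟨hinj.injOn, Subset.antisymm ?_ ?_⟩
  · rintro _ ⟨x, hx, rfl⟩
    by_contra hn
    rw [mem_ball_zero_iff, not_lt] at hn
    have := hinj (hfix _ hn)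
    rw [this, ← not_lt] at hn
    exact hn (mem_ball_zero_iff.1 hx)
  · intro y hy
    obtain ⟨x, rfl⟩ := e.surjective y
    refine ⟨x, ?_, rfl⟩
    by_contra hn
    rw [mem_ball_zero_iff, not_lt] at hn
    rw [he, hfix x hn] at hy
    exact absurd (mem_ball_zero_iff.1 hy) (not_lt.2 hn)

/-- For small t ≥ 0 the map `id + t h` permutes the ball with positive Jacobian, so the integral of
its Jacobian is the volume of the ball. The Jacobian is polynomial in t, and interpolation from
small nodes reaches t = 1, where injectivity may fail. -/
theorem integral_det_of_lipschitz_perturbation [MeasurableSpace V] [BorelSpace V] [Nontrivial V]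
    {R : ℝ} {h : V → V} {K : NNReal} (hh : LipschitzWith K h) (hout : ∀ x, R ≤ ‖x‖ → h x = 0)
    (hdiff : ∀ x ∈ Metric.ball (0 : V) R, DifferentiableAt ℝ h x) :
    ∫ x in Metric.ball (0 : V) R, ((1 : V →L[ℝ] V) + fderiv ℝ h x).det =
      volume.real (Metric.ball (0 : V) R) := by
  have : CompleteSpace V := FiniteDimensional.complete ℝ V
  obtain ⟨δ, hδ, hdet⟩ : ∃ δ > 0, ∀ X : V →L[ℝ] V, dist X 1 < δ → 0 < X.det := by
    have h1 : (0 : ℝ) < (1 : V →L[ℝ] V).det := by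
      have : (1 : V →L[ℝ] V).det = 1 := LinearMap.det_id
      simp [this]
    exact Metric.eventually_nhds_iff.1
      (ContinuousLinearMap.continuous_det.continuousAt.eventually_const_lt h1)
  obtain ⟨t₀, ht₀, ht₀K, ht₀δ⟩ : ∃ t₀ : ℝ, 0 < t₀ ∧ t₀ * K < 1 ∧ t₀ * K < δ := by
    refine ⟨min 1 δ / (K + 1), by positivity, ?_, ?_⟩ <;>
    · have : min 1 δ / (K + 1) * K < min 1 δ := by
        rw [div_mul_eq_mul_div, div_lt_iff₀ (by positivity)]
        nlinarith [lt_min one_pos hδ]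
      first | exact this.trans_le (min_le_left _ _) | exact this.trans_le (min_le_right _ _)
  have key : ∀ t : NNReal, (t : ℝ) ≤ t₀ →
      IntegrableOn (fun x => ((1 : V →L[ℝ] V) + (t : ℝ) • fderiv ℝ h x).det)
        (Metric.ball (0 : V) R) ∧
      ∫ x in Metric.ball (0 : V) R, ((1 : V →L[ℝ] V) + (t : ℝ) • fderiv ℝ h x).det =
        volume.real (Metric.ball (0 : V) R) := by
    intro t ht
    have htK : (t : ℝ) * K ≤ t₀ * K := by gcongr
    obtain ⟨hinj, himg⟩ := image_ball_of_lipschitz_perturbation hh hout (t := t) (by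
      exact_mod_cast htK.trans_lt ht₀K)
    have hder : ∀ x ∈ Metric.ball (0 : V) R, HasFDerivWithinAt (fun x => x + (t : ℝ) • h x)
        ((1 : V →L[ℝ] V) + (t : ℝ) • fderiv ℝ h x) (Metric.ball 0 R) x := fun x hx =>
      ((hasFDerivAt_id x).add ((hdiff x hx).hasFDerivAt.const_smul (t : ℝ))).hasFDerivWithinAt
    have hpos : ∀ x, 0 < ((1 : V →L[ℝ] V) + (t : ℝ) • fderiv ℝ h x).det := by
      intro x
      apply hdet
      rw [dist_eq_norm, add_sub_cancel_left, norm_smul, Real.norm_eq_abs, NNReal.abs_eq]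
      exact lt_of_le_of_lt (le_trans (by gcongr; exact norm_fderiv_le_of_lipschitz ℝ hh) htK) ht₀δ
    have hI := lintegral_abs_det_fderiv_eq_addHaar_image volume Metric.isOpen_ball.measurableSet
      hder hinj
    rw [himg] at hI
    have hmeas : Measurable fun x => ((1 : V →L[ℝ] V) + (t : ℝ) • fderiv ℝ h x).det :=
      ContinuousLinearMap.continuous_det.measurable.comp
        (((measurable_fderiv ℝ h).const_smul (t : ℝ)).const_add 1)
    simp_rw [abs_of_pos (hpos _)] at hI
    constructor
    · refine ⟨hmeas.aestronglyMeasurable, ?_⟩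
      rw [hasFiniteIntegral_iff_ofReal (ae_of_all _ fun x => (hpos x).le), hI]
      exact measure_ball_lt_top
    · rw [integral_eq_lintegral_of_nonneg_ae (ae_of_all _ fun x => (hpos x).le)
        hmeas.aestronglyMeasurable, hI]
      rfl
  -- Distinct interpolation nodes, all in the range of t covered by `key`.
  let v : ℕ → ℝ := fun i => t₀ / (i + 1)
  have hv0 : ∀ i, 0 ≤ v i := fun i => by positivity
  have hv : Function.Injective v := by
    intro i j hij
    simp only [v] at hij
    rw [div_eq_div_iff (by positivity) (by positivity)] at hij
    have := mul_left_cancel₀ ht₀.ne' hij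
    exact_mod_cast (by linarith : (i : ℝ) = j)
  have hvle : ∀ i, v i ≤ t₀ := fun i => div_le_self ht₀.le (by simp)
  have keyv : ∀ i, IntegrableOn (fun x => ((1 : V →L[ℝ] V) + v i • fderiv ℝ h x).det)
        (Metric.ball (0 : V) R) ∧
      ∫ x in Metric.ball (0 : V) R, ((1 : V →L[ℝ] V) + v i • fderiv ℝ h x).det =
        volume.real (Metric.ball (0 : V) R) := fun i => key ⟨v i, hv0 i⟩ (hvle i)
  rw [show (fun x => ((1 : V →L[ℝ] V) + fderiv ℝ h x).det) = _ from
    funext fun x => det_one_add_eq_sum (fderiv ℝ h x) hv]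
  rw [integral_finsetSum _ fun i _ => ((keyv i).1.mul_const _)]
  have : ∀ i, ∫ x in Metric.ball (0 : V) R, ((1 : V →L[ℝ] V) + v i • fderiv ℝ h x).det *
        (Lagrange.basis (Finset.range (Module.finrank ℝ V + 1)) v i).eval 1 =
      volume.real (Metric.ball (0 : V) R) *
        (Lagrange.basis (Finset.range (Module.finrank ℝ V + 1)) v i).eval 1 := fun i => by
    rw [integral_mul_const]
    congr 1
    exact (keyv i).2
  simp_rw [this]
  rw [← Finset.mul_sum, sum_eval_lagrange_basis _ hv, mul_one]

/-- Since |F|² is constant inside the ball, the range of `F'` is orthogonal to `F x ≠ 0`. Hence det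
F' = 0 there, while its integral would have to be the volume of the ball. -/
theorem not_lipschitz_retraction [Nontrivial V] {R : ℝ} (hR : 0 < R) {F : V → V} {K : NNReal}
    (hF : LipschitzWith K F) (hdiff : ∀ x ∈ Metric.ball (0 : V) R, DifferentiableAt ℝ F x)
    (hout : ∀ x, R ≤ ‖x‖ → F x = x) (hin : ∀ x, ‖x‖ < R → ‖F x‖ = R) : False := by
  borelize V
  have h1 := integral_det_of_lipschitz_perturbation (h := fun x => F x - x) (hF.sub LipschitzWith.id)
    (fun x hx => by simp [hout x hx]) (fun x hx => (hdiff x hx).sub differentiableAt_id)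
  have h2 : ∫ x in Metric.ball (0 : V) R, ((1 : V →L[ℝ] V) + fderiv ℝ (fun x => F x - x) x).det
      = 0 := by
    refine setIntegral_eq_zero_of_forall_eq_zero fun x hx => ?_
    have hd := hdiff x hx
    have : (1 : V →L[ℝ] V) + fderiv ℝ (fun x => F x - x) x = fderiv ℝ F x := by
      rw [fderiv_fun_sub hd differentiableAt_fun_id]
      simp [ContinuousLinearMap.one_def]
    rw [this]
    by_contra hdet
    have hconst : (fun y => ‖F y‖ ^ 2) =ᶠ[nhds x] fun _ => R ^ 2 := by
      filter_upwards [Metric.isOpen_ball.mem_nhds hx] with y hy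
      rw [hin y (mem_ball_zero_iff.1 hy)]
    have hder := hd.hasFDerivAt.norm_sq
    have hz : ∀ w, inner ℝ (F x) (fderiv ℝ F x w) = 0 := by
      intro w
      have h0 := (hder.congr_of_eventuallyEq hconst.symm).unique (hasFDerivAt_const (R ^ 2) x)
      have := congrArg (fun L : V →L[ℝ] ℝ => L w) h0
      simpa using this
    let e := (fderiv ℝ F x).toContinuousLinearEquivOfDetNeZero hdet
    have := hz (e.symm (F x))
    have he : fderiv ℝ F x (e.symm (F x)) = F x := e.apply_symm_apply (F x)
    rw [he, real_inner_self_eq_norm_sq, hin x (mem_ball_zero_iff.1 hx)] at this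
    exact absurd this (by positivity)
  rw [h2] at h1
  exact absurd h1.symm (ENNReal.toReal_pos (Metric.measure_ball_pos volume _ hR).ne'
    measure_ball_lt_top.ne).ne'

omit [FiniteDimensional ℝ V] in
-- A segment from inside to outside the ball crosses the sphere, where `h` vanishes, so the crossing
-- point bounds `h` at the inner end.
theorem lipschitzWith_ite_norm_lt {R : ℝ} {h : V → V} {K : NNReal}
    (hK : LipschitzOnWith K h (Metric.closedBall 0 R)) (h0 : ∀ x, ‖x‖ = R → h x = 0) :
    LipschitzWith K (fun x => if ‖x‖ < R then h x else 0) := by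
  have hcross : ∀ x y : V, ‖x‖ < R → R ≤ ‖y‖ → dist (h x) 0 ≤ K * dist x y := by
    intro x y hx hy
    obtain ⟨z, hz, hzR⟩ : R ∈ (fun z : V => ‖z‖) '' segment ℝ x y :=
      (convex_segment x y).isPreconnected.intermediate_value (left_mem_segment ℝ x y)
        (right_mem_segment ℝ x y) continuous_norm.continuousOn ⟨hx.le, hy⟩
    have h1 := hK.dist_le_mul x (mem_closedBall_zero_iff.2 hx.le) z (mem_closedBall_zero_iff.2 hzR.le)
    rw [h0 z hzR] at h1
    have h2 := (mem_segment_iff_wbtw.1 hz).dist_add_dist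
    refine h1.trans (mul_le_mul_of_nonneg_left ?_ K.2)
    linarith [dist_nonneg (x := z) (y := y)]
  refine LipschitzWith.of_dist_le_mul fun x y => ?_
  by_cases hx : ‖x‖ < R <;> by_cases hy : ‖y‖ < R
  · simpa [hx, hy] using hK.dist_le_mul x (mem_closedBall_zero_iff.2 hx.le) y
      (mem_closedBall_zero_iff.2 hy.le)
  · simpa [hx, hy] using hcross x y hx (not_lt.1 hy)
  · simpa [hx, hy, dist_comm] using hcross y x hy (not_lt.1 hx)
  · simp only [hx, hy, if_false, dist_self]; positivity

/-- A continuous vector field which points outwards far away has a zero. -/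
theorem exists_zero_of_coercive {Ψ : V → V} (hΨ : Continuous Ψ) {R : ℝ} (hR : 0 < R)
    (hpos : ∀ x, R ≤ ‖x‖ → 0 < inner ℝ x (Ψ x)) : ∃ x, Ψ x = 0 := by
  rcases subsingleton_or_nontrivial V with hV | hV
  · exact ⟨0, Subsingleton.elim _ _⟩
  by_contra! hne
  -- The first entry keeps a smooth approximation free of zeros, the second keeps it pointing
  -- outwards for |x| ≥ R. The term `R - ‖x‖` only ensures positivity inside the ball.
  let ε : V → ℝ := fun x => min ‖Ψ x‖ (max (inner ℝ x (Ψ x)) (R - ‖x‖) / (‖x‖ + 1))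
  have hεc : Continuous ε := by
    refine hΨ.norm.min (((continuous_id.inner hΨ).max (by fun_prop)).div (by fun_prop) fun x => ?_)
    positivity
  have hε : ∀ x, 0 < ε x := fun x => lt_min (norm_pos_iff.2 (hne x)) (div_pos (by
    rcases le_or_gt R ‖x‖ with h | h
    · exact lt_max_of_lt_left (hpos x h)
    · exact lt_max_of_lt_right (by linarith)) (by positivity))
  obtain ⟨Ψ', hsm, happ, -⟩ := hΨ.exists_contDiff_approx 1 hεc hε
  have hne' : ∀ x, Ψ' x ≠ 0 := fun x h0 => by
    have := (happ x).trans_le (min_le_left _ _)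
    rw [h0, dist_zero_left] at this
    exact lt_irrefl _ this
  have hpos' : ∀ x, R ≤ ‖x‖ → 0 < inner ℝ x (Ψ' x) := fun x hx => by
    have h1 := (happ x).trans_le (min_le_right _ _)
    rw [max_eq_left ((sub_nonpos.2 hx).trans (hpos x hx).le), lt_div_iff₀ (by positivity),
      dist_eq_norm] at h1
    have h2 := abs_le.1 (abs_real_inner_le_norm x (Ψ' x - Ψ x))
    rw [inner_sub_right] at h2
    nlinarith [h2.1, norm_nonneg (Ψ' x - Ψ x)]
  -- The argument is 0 at |x| = R and 1 at |x| = 2R, so `G` below deforms the field into the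
  -- identity across this shell. Both fields point outwards there, so no zero appears, and
  -- normalizing `G` to length 2R gives a forbidden retraction.
  let s : V → ℝ := fun x => Real.smoothTransition (‖x‖ ^ 2 / (3 * R ^ 2) - 1 / 3)
  have hs : ContDiff ℝ 1 s :=
    Real.smoothTransition.contDiff.comp (((contDiff_norm_sq ℝ).div_const _).sub contDiff_const)
  have hs0 : ∀ x, ‖x‖ ≤ R → s x = 0 := fun x hx => Real.smoothTransition.zero_of_nonpos (by
    rw [sub_nonpos, div_le_div_iff₀ (by positivity) (by norm_num)]
    nlinarith [norm_nonneg x])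
  have hs1 : ∀ x, 2 * R ≤ ‖x‖ → s x = 1 := fun x hx => Real.smoothTransition.one_of_one_le (by
    rw [le_sub_iff_add_le, le_div_iff₀ (by positivity)]
    nlinarith [norm_nonneg x])
  let G : V → V := fun x => (1 - s x) • Ψ' x + s x • x
  have hG : ContDiff ℝ 1 G := ((contDiff_const.sub hs).smul hsm).add (hs.smul contDiff_id)
  have hG0 : ∀ x, G x ≠ 0 := fun x => by
    rcases le_or_gt ‖x‖ R with h | h
    · simpa [G, hs0 x h] using hne' x
    · intro hz
      have h1 : inner ℝ x (G x) = (1 - s x) * inner ℝ x (Ψ' x) + s x * ‖x‖ ^ 2 := by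
        simp only [G, inner_add_right, inner_smul_right, real_inner_self_eq_norm_sq]
      rw [hz, inner_zero_right] at h1
      have h2 := hpos' x h.le
      have h3 : 0 ≤ s x := Real.smoothTransition.nonneg _
      have h4 : s x ≤ 1 := Real.smoothTransition.le_one _
      have h5 : 0 < ‖x‖ ^ 2 := by have := hR.trans h; positivity
      rcases h4.eq_or_lt with h6 | h6
      · rw [h6] at h1; linarith
      · nlinarith [mul_pos (sub_pos.2 h6) h2, mul_nonneg h3 h5.le]
  let F₁ : V → V := fun x => (2 * R / ‖G x‖) • G x
  have hF₁ : ContDiff ℝ 1 F₁ :=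
    (contDiff_const.div (hG.norm ℝ hG0) fun x => norm_ne_zero_iff.2 (hG0 x)).smul hG
  have hF₁n : ∀ x, ‖F₁ x‖ = 2 * R := fun x => by
    have := norm_pos_iff.2 (hG0 x)
    simp only [F₁, norm_smul, norm_div, Real.norm_eq_abs, abs_of_pos (show 0 < 2 * R by positivity),
      abs_norm]
    field_simp
  have hF₁s : ∀ x, ‖x‖ = 2 * R → F₁ x = x := fun x hx => by
    have : G x = x := by simp [G, hs1 x hx.ge]
    simp only [F₁, this, hx]
    rw [div_self (by positivity), one_smul]
  obtain ⟨K, hK⟩ := ((hF₁.sub contDiff_id).locallyLipschitz.locallyLipschitzOn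
    (s := Metric.closedBall (0 : V) (2 * R))).exists_lipschitzOnWith_of_compact
      (isCompact_closedBall _ _)
  have hL := lipschitzWith_ite_norm_lt hK (fun x hx => by simp [hF₁s x hx])
  refine not_lipschitz_retraction (R := 2 * R) (by positivity) (hL.add LipschitzWith.id) ?_ ?_ ?_
  · intro x hx
    refine DifferentiableAt.congr_of_eventuallyEq (hF₁.differentiable one_ne_zero x) ?_
    filter_upwards [Metric.isOpen_ball.mem_nhds hx] with y hy
    simp [mem_ball_zero_iff.1 hy]
  · intro x hx
    simp [not_lt.2 hx]
  · intro x hx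
    simp [hx, hF₁n]

end Retraction

end InverseKI

/-! ### The Poincaré–Miranda theorem -/

namespace InverseKI

/-- The cube `[-1, 1]ⁿ`. -/
def cube (n : ℕ) : Set (E n) := {x | ∀ i, |x i| ≤ 1}

theorem isCompact_cube (n : ℕ) : IsCompact (cube n) := by
  have h : cube n = (EuclideanSpace.equiv (Fin n) ℝ).toHomeomorph ⁻¹' Icc (-1) 1 := by
    ext x
    simp [cube, abs_le, Pi.le_def, forall_and]
  rw [h, Homeomorph.isCompact_preimage]
  exact isCompact_Icc

/-- The coordinatewise truncation of `ℝⁿ` to the cube `[-1, 1]ⁿ`. -/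
noncomputable def clamp {n : ℕ} (x : E n) : E n := WithLp.toLp 2 fun i => max (-1) (min 1 (x i))

theorem continuous_clamp {n : ℕ} : Continuous (clamp : E n → E n) := by
  unfold clamp
  fun_prop

theorem clamp_mem_cube {n : ℕ} (x : E n) : clamp x ∈ cube n := fun i => by
  simp [clamp, abs_le]

/-- Extending `Φ` by `Φ (clamp x) + (x - clamp x)` yields a coercive field. A zero of it cannot lie
outside the cube: in a truncated coordinate the face condition makes both terms push the same way.
-/
theorem poincare_miranda {n : ℕ} {Φ : E n → E n} (hΦ : ContinuousOn Φ (cube n))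
    (hr : ∀ x ∈ cube n, ∀ i, x i = 1 → 0 ≤ Φ x i) (hl : ∀ x ∈ cube n, ∀ i, x i = -1 → Φ x i ≤ 0) :
    ∃ x ∈ cube n, Φ x = 0 := by
  obtain ⟨M, hM⟩ := (isCompact_cube n).exists_bound_of_continuousOn hΦ
  have hM0 : 0 ≤ M := (norm_nonneg _).trans (hM _ (clamp_mem_cube 0))
  let Ψ : E n → E n := fun x => Φ (clamp x) + (x - clamp x)
  have hΨ : Continuous Ψ :=
    (hΦ.comp_continuous continuous_clamp clamp_mem_cube).add (continuous_id.sub continuous_clamp)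
  have hcases : ∀ (x : E n) i, (x i ≤ -1 ∧ clamp x i = -1) ∨ (|x i| ≤ 1 ∧ clamp x i = x i) ∨
      (1 ≤ x i ∧ clamp x i = 1) := fun x i => by
    simp only [clamp, abs_le]
    rcases le_total (x i) (-1) with h | h
    · left; exact ⟨h, by rw [min_eq_right (by linarith), max_eq_left h]⟩
    · rcases le_total (x i) 1 with h' | h'
      · right; left; exact ⟨⟨h, h'⟩, by rw [min_eq_right h', max_eq_right h]⟩
      · right; right; exact ⟨h', by rw [min_eq_left h']; norm_num⟩
  obtain ⟨x, hx⟩ := exists_zero_of_coercive hΨ (R := 2 * n * (M + 1) + 1) (by positivity) (by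
    intro x hx
    -- Where the coordinate is truncated, x² - |x| ≥ x²/2 - 1/2; otherwise |x| ≤ 1 and the product
    -- is at least -M. Summing over coordinates explains the radius chosen above.
    have hterm : ∀ i, x i ^ 2 / 2 - (M + 1 / 2) ≤ x i * Ψ x i := by
      intro i
      have hb : |Φ (clamp x) i| ≤ M :=
        (PiLp.norm_apply_le (Φ (clamp x)) i).trans (hM _ (clamp_mem_cube x))
      simp only [Ψ, PiLp.add_apply, PiLp.sub_apply]
      rcases hcases x i with ⟨h, hc⟩ | ⟨h, hc⟩ | ⟨h, hc⟩
      · have := hl _ (clamp_mem_cube x) i hc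
        rw [hc]; nlinarith
      · rw [hc]
        have h1 : |x i * Φ (clamp x) i| ≤ 1 * M := by rw [abs_mul]; gcongr
        have h2 : x i ^ 2 ≤ 1 := by rw [← sq_abs]; nlinarith [abs_nonneg (x i)]
        have := (abs_le.1 h1).1
        nlinarith
      · have := hr _ (clamp_mem_cube x) i hc
        rw [hc]; nlinarith
    have hsum : inner ℝ x (Ψ x) = ∑ i, x i * Ψ x i := by
      simp [PiLp.inner_apply, mul_comm]
    have hge := Finset.sum_le_sum fun i (_ : i ∈ Finset.univ) => hterm i
    rw [← hsum, Finset.sum_sub_distrib, ← Finset.sum_div, ← EuclideanSpace.real_norm_sq_eq] at hge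
    simp only [Finset.sum_const, Finset.card_univ, Fintype.card_fin, nsmul_eq_mul] at hge
    have hn : (0 : ℝ) ≤ n * (M + 1) := by positivity
    have hsq : 2 * (n * (M + 1)) + 1 ≤ ‖x‖ ^ 2 := by nlinarith
    nlinarith)
  have hcl : clamp x = x := by
    ext i
    have hz : Φ (clamp x) i + (x i - clamp x i) = 0 := by
      simpa [Ψ] using congrArg (fun y : E n => y i) hx
    rcases hcases x i with ⟨h, hc⟩ | ⟨h, hc⟩ | ⟨h, hc⟩
    · have := hl _ (clamp_mem_cube x) i hc
      rw [hc] at hz ⊢; linarith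
    · exact hc
    · have := hr _ (clamp_mem_cube x) i hc
      rw [hc] at hz ⊢; linarith
  refine ⟨x, hcl ▸ clamp_mem_cube x, ?_⟩
  simpa [Ψ, hcl] using hx

/-! ### Finite-to-one maps onto null sets -/

/-- The points of the fibre have disjoint neighbourhoods on which `π` is nearly constant. By
compactness all fibres over a small ball around `y` stay inside them, and `c` takes on each the
value of `π` at its centre. -/
theorem exists_locally_constant_approx {X Y F : Type*} [TopologicalSpace X] [CompactSpace X]
    [T2Space X] [PseudoMetricSpace Y] [T2Space Y] [NormedAddCommGroup F] {f : X → Y}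
    (hf : Continuous f) {π : X → F} (hπ : Continuous π) {δ : ℝ} (hδ : 0 < δ) (y : Y)
    (hfin : (f ⁻¹' {y}).Finite) :
    ∃ r > 0, ∃ c : X → F, (range c).Finite ∧ ContinuousOn c (f ⁻¹' Metric.ball y r) ∧
      ∀ x ∈ f ⁻¹' Metric.ball y r, ‖c x - π x‖ ≤ δ := by
  classical
  obtain ⟨U, hU, hdisj⟩ := hfin.t2_separation
  let W : X → Set X := fun a => U a ∩ {x | ‖π a - π x‖ < δ}
  have hWo : ∀ a, IsOpen (W a) := fun a =>
    (hU a).2.inter (isOpen_lt (by fun_prop) continuous_const)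
  have hWa : ∀ a, a ∈ W a := fun a => ⟨(hU a).1, by simpa using hδ⟩
  have hC : IsClosed (f '' (⋃ a ∈ f ⁻¹' {y}, W a)ᶜ) :=
    ((isOpen_biUnion fun a _ => hWo a).isClosed_compl.isCompact.image hf).isClosed
  have hyC : y ∈ (f '' (⋃ a ∈ f ⁻¹' {y}, W a)ᶜ)ᶜ := by
    rintro ⟨x, hx, hxy⟩
    exact hx (mem_biUnion (show x ∈ f ⁻¹' {y} from hxy) (hWa x))
  obtain ⟨r, hr, hball⟩ := Metric.isOpen_iff.1 hC.isOpen_compl y hyC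
  have hcov : ∀ x ∈ f ⁻¹' Metric.ball y r, ∃ a ∈ f ⁻¹' {y}, x ∈ W a := by
    intro x hx
    by_contra hn
    exact hball hx ⟨x, by simpa using hn, rfl⟩
  let c : X → F := fun x => if h : ∃ a ∈ f ⁻¹' {y}, x ∈ W a then π h.choose else 0
  have hc : ∀ a ∈ f ⁻¹' {y}, ∀ x ∈ W a, c x = π a := by
    intro a ha x hx
    have h : ∃ a ∈ f ⁻¹' {y}, x ∈ W a := ⟨a, ha, hx⟩
    have hch := h.choose_spec
    simp only [c, dif_pos h]
    by_contra hne
    exact (hdisj hch.1 ha fun h' => hne (congrArg π h')).le_bot ⟨hch.2.1, hx.1⟩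
  refine ⟨r, hr, c, ?_, ?_, ?_⟩
  · refine ((hfin.image π).union (finite_singleton (0 : F))).subset ?_
    rintro _ ⟨x, rfl⟩
    by_cases h : ∃ a ∈ f ⁻¹' {y}, x ∈ W a
    · obtain ⟨a, ha, hx⟩ := h
      exact Or.inl ⟨a, ha, (hc a ha x hx).symm⟩
    · exact Or.inr (by simp only [c, dif_neg h]; rfl)
  · intro x hx
    obtain ⟨a, ha, hxa⟩ := hcov x hx
    refine ContinuousAt.continuousWithinAt ?_
    refine continuousAt_const.congr (f := fun _ => π a) ?_
    filter_upwards [(hWo a).mem_nhds hxa] with x' hx' using (hc a ha x' hx').symm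
  · intro x hx
    obtain ⟨a, ha, hxa⟩ := hcov x hx
    rw [hc a ha x hxa]
    exact hxa.2.le

theorem euclideanHausdorffMeasure_image_eq_zero {X Y : Type*} [EMetricSpace X] [MeasurableSpace X]
    [BorelSpace X] [EMetricSpace Y] [MeasurableSpace Y] [BorelSpace Y] {d : ℕ} {K : NNReal}
    {f : X → Y} {s : Set X} (hf : LipschitzOnWith K f s) (hs : (μHE[d] : Measure X) s = 0) :
    (μHE[d] : Measure Y) (f '' s) = 0 := by
  rw [Measure.euclideanHausdorffMeasure_def, Measure.smul_apply, ENNReal.smul_def, smul_eq_mul,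
    mul_eq_zero] at hs ⊢
  refine hs.imp id fun h => ?_
  have := hf.hausdorffMeasure_image_le (d := d) (by positivity)
  rw [h, mul_zero] at this
  exact le_antisymm this bot_le

/-- A map of a compact space can be perturbed to have a null image if the space has a continuous
finite-to-one map onto a set of zero Hausdorff measure. -/
theorem exists_approx_null_range {X : Type*} [TopologicalSpace X] [CompactSpace X] [T2Space X]
    {n m : ℕ} {f : X → E n} (hf : Continuous f) (hfin : ∀ y, (f ⁻¹' {y}).Finite)
    (hnull : (μHE[m] : Measure (E n)) (range f) = 0) {π : X → E m} (hπ : Continuous π) {δ : ℝ}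
    (hδ : 0 < δ) :
    ∃ ψ : X → E m, Continuous ψ ∧ (∀ x, ‖ψ x - π x‖ ≤ δ) ∧ volume (range ψ) = 0 := by
  choose r hr c hcfin hccont hcapp using
    fun y => exists_locally_constant_approx hf hπ hδ y (hfin y)
  obtain ⟨J, -, hJ⟩ := (isCompact_range hf).elim_nhds_subcover (fun y => Metric.ball y (r y))
    fun y _ => Metric.ball_mem_nhds y (hr y)
  let φ : (y : E n) → ContDiffBump y := fun y => ⟨r y / 2, r y, half_pos (hr y), half_lt_self (hr y)⟩
  let Λ : E n → ℝ := fun z => ∑ y ∈ J, φ y z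
  have hφ : ∀ y, ContDiff ℝ 1 (φ y) := fun y => (φ y).contDiff
  have hφz : ∀ y z, z ∉ Metric.ball y (r y) → φ y z = 0 := fun y z hz =>
    (φ y).zero_of_le_dist (by simpa using hz)
  have hΛ : ContDiff ℝ 1 Λ := ContDiff.sum fun y _ => hφ y
  have hΛpos : ∀ z ∈ range f, 0 < Λ z := fun z hz => by
    obtain ⟨y, hy, hzy⟩ := mem_iUnion₂.1 (hJ hz)
    exact Finset.sum_pos' (fun y _ => (φ y).nonneg) ⟨y, hy, (φ y).pos_of_mem_ball hzy⟩
  have hΛ0 : ∀ x, Λ (f x) ≠ 0 := fun x => (hΛpos _ ⟨x, rfl⟩).ne'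
  -- Gluing by a partition of unity pulled back from the target: for fixed values `v`, `G v` is a C¹
  -- function of `f x` alone near `range f`.
  let G : (E n → E m) → E n → E m := fun v z => (Λ z)⁻¹ • ∑ y ∈ J, φ y z • v y
  let ψ : X → E m := fun x => G (fun y => c y x) (f x)
  refine ⟨ψ, ?_, fun x => ?_, ?_⟩
  · refine ((hΛ.continuous.comp hf).inv₀ hΛ0).smul (continuous_finsetSum _ fun y _ => ?_)
    rw [continuous_iff_continuousAt]
    intro x
    by_cases hx : f x ∈ Metric.ball y (r y)
    · exact ((hφ y).continuous.comp hf).continuousAt.smul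
        ((hccont y).continuousAt ((Metric.isOpen_ball.preimage hf).mem_nhds hx))
    -- Outside the ball `c y` may jump, but it is bounded and its weight tends to 0.
    · obtain ⟨C, hC⟩ := (hcfin y).isBounded.exists_norm_le
      have h0 : Filter.Tendsto (fun x => φ y (f x)) (nhds x) (nhds 0) := by
        rw [← hφz y _ hx]
        exact ((hφ y).continuous.comp hf).continuousAt
      have := h0.zero_smul_isBoundedUnder_le (g := c y)
        (Filter.isBoundedUnder_of ⟨C, fun x' => hC _ ⟨x', rfl⟩⟩)
      rw [ContinuousAt, hφz y _ hx, zero_smul]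
      exact this
  · have h1 : ψ x - π x = (Λ (f x))⁻¹ • ∑ y ∈ J, φ y (f x) • (c y x - π x) := by
      simp only [smul_sub, Finset.sum_sub_distrib, ← Finset.sum_smul, ψ, G]
      rw [smul_smul, inv_mul_cancel₀ (hΛ0 x), one_smul]
    have h2 : ‖∑ y ∈ J, φ y (f x) • (c y x - π x)‖ ≤ Λ (f x) * δ := by
      rw [Finset.sum_mul]
      refine norm_sum_le_of_le _ fun y _ => ?_
      rw [norm_smul, Real.norm_eq_abs, abs_of_nonneg (φ y).nonneg]
      by_cases hx : f x ∈ Metric.ball y (r y)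
      · exact mul_le_mul_of_nonneg_left (hcapp y x hx) (φ y).nonneg
      · simp [hφz y _ hx]
    have hp := hΛpos _ ⟨x, rfl⟩
    rw [h1, norm_smul, norm_inv, Real.norm_eq_abs, abs_of_pos hp, inv_mul_le_iff₀ hp]
    exact h2
  -- Each `c y` has finitely many values, so the range of `ψ` lies in finitely many Lipschitz images
  -- of the null set `range f`.
  · have hsub : range ψ ⊆ ⋃ v ∈ {v : J → E m | ∀ y : J, v y ∈ range (c y)},
        G (fun y => if h : y ∈ J then v ⟨y, h⟩ else 0) '' range f := by
      rintro _ ⟨x, rfl⟩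
      refine mem_biUnion (x := fun y : J => c y x) (fun y => ⟨x, rfl⟩) ⟨f x, ⟨x, rfl⟩, ?_⟩
      simp only [G, ψ]
      congr 1
      refine Finset.sum_congr rfl fun y hy => ?_
      simp [hy]
    have hfinv : {v : J → E m | ∀ y : J, v y ∈ range (c y)}.Finite :=
      Set.Finite.pi' fun y => hcfin y
    refine measure_mono_null hsub ((measure_biUnion_null_iff hfinv.countable).2 fun v _ => ?_)
    have hL : LocallyLipschitzOn (range f) (G (fun y => if h : y ∈ J then v ⟨y, h⟩ else 0)) := by
      intro z hz
      have hz' : ContDiffAt ℝ 1 (G (fun y => if h : y ∈ J then v ⟨y, h⟩ else 0)) z :=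
        (hΛ.contDiffAt.inv (hΛpos z hz).ne').smul
          (ContDiff.sum fun y _ => (hφ y).smul contDiff_const).contDiffAt
      obtain ⟨K, t, ht, hK⟩ := hz'.exists_lipschitzOnWith
      exact ⟨K, t, mem_nhdsWithin_of_mem_nhds ht, hK⟩
    obtain ⟨K, hK⟩ := hL.exists_lipschitzOnWith_of_compact (isCompact_range hf)
    have := euclideanHausdorffMeasure_image_eq_zero hK hnull
    rwa [EuclideanSpace.euclideanHausdorffMeasure_eq_volume] at this

end InverseKI

/-! ### Finite-to-one images of separating sets -/

namespace InverseKI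

/-- The image of a set separating two opposite faces of a cube under a finite-to-one continuous map
has positive Hausdorff measure of codimension one. -/
theorem cube_crossing {m N : ℕ} {f : E (m + 1) → E N} (hf : ContinuousOn f (cube (m + 1)))
    (hfin : ∀ y, (cube (m + 1) ∩ f ⁻¹' {y}).Finite) {g : E (m + 1) → ℝ}
    (hg : ContinuousOn g (cube (m + 1))) (hl : ∀ z ∈ cube (m + 1), z 0 = -1 → g z ≤ 0)
    (hr : ∀ z ∈ cube (m + 1), z 0 = 1 → 0 ≤ g z) :
    (μHE[m] : Measure (E N)) (f '' {z | z ∈ cube (m + 1) ∧ g z = 0}) ≠ 0 := by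
  intro hnull
  set Z : Set (E (m + 1)) := {z | z ∈ cube (m + 1) ∧ g z = 0} with hZ
  have hZc : IsClosed Z :=
    hg.preimage_isClosed_of_isClosed (isCompact_cube _).isClosed (isClosed_singleton (x := (0 : ℝ)))
  have hZK : IsCompact Z := (isCompact_cube _).of_isClosed_subset hZc fun z hz => hz.1
  have : CompactSpace Z := isCompact_iff_compactSpace.1 hZK
  let tail : E (m + 1) → E m := fun x => WithLp.toLp 2 fun i => x i.succ
  have htail : Continuous tail := by fun_prop
  have hfZ : Continuous (Z.domRestrict f) := (hf.mono fun z hz => hz.1).domRestrict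
  obtain ⟨ψ, hψ, hψπ, hψn⟩ := exists_approx_null_range hfZ (m := m)
    (fun y => by
      refine Set.Finite.of_finite_image (f := Subtype.val) ((hfin y).subset ?_)
        Subtype.val_injective.injOn
      rintro _ ⟨x, hx, rfl⟩
      exact ⟨x.2.1, hx⟩)
    (by rwa [range_domRestrict]) (π := fun z : Z => tail z) (htail.comp continuous_subtype_val)
    (δ := 1 / 4) (by norm_num)
  obtain ⟨c, hc, hcψ⟩ : ∃ c ∈ Metric.ball (0 : E m) (1 / 4), c ∉ range ψ := by
    by_contra! h
    exact (Metric.measure_ball_pos volume (0 : E m) (by norm_num : (0 : ℝ) < 1 / 4)).ne'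
      (measure_mono_null h hψn)
  let τ : BoundedContinuousFunction Z (E m) :=
    .mkOfCompact ⟨fun z => ψ z - tail z, hψ.sub (htail.comp continuous_subtype_val)⟩
  obtain ⟨T, hTn, hT⟩ := BoundedContinuousFunction.exists_norm_eq_domRestrict_eq hZc ℝ τ
  have hTb : ∀ x, ‖T x‖ ≤ 1 / 4 := fun x => (T.norm_coe_le_norm x).trans (hTn.le.trans
    ((BoundedContinuousFunction.norm_le (by norm_num)).2 fun z => hψπ z))
  have hTZ : ∀ z : Z, T z = ψ z - tail z := fun z => congrArg (fun h => h z) hT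
  -- On `Z` the last m coordinates equal ψ - c, which never vanishes; a Poincaré–Miranda zero lies
  -- on `Z` because its first coordinate is `g`. The perturbation `T - c` is at most 1/2, which
  -- preserves the signs on the faces.
  let Φ : E (m + 1) → E (m + 1) := fun x =>
    WithLp.toLp 2 (Fin.cons (g x) fun i => x i.succ + T x i - c i)
  have hΦ : ContinuousOn Φ (cube (m + 1)) := by
    refine (PiLp.continuous_toLp 2 _).comp_continuousOn (continuousOn_pi.2 fun i => ?_)
    refine Fin.cases ?_ (fun i => ?_) i
    · simpa using hg
    · simp only [Fin.cons_succ]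
      exact Continuous.continuousOn (by fun_prop)
  have hsmall : ∀ x i, |T x i - c i| ≤ 1 / 2 := fun x i => by
    have h1 := (PiLp.norm_apply_le (T x) i).trans (hTb x)
    have h2 := (PiLp.norm_apply_le c i).trans (mem_ball_zero_iff.1 hc).le
    rw [Real.norm_eq_abs] at h1 h2
    linarith [abs_sub (T x i) (c i)]
  obtain ⟨x, hx, hx0⟩ := poincare_miranda hΦ (by
    intro x hx i
    refine Fin.cases ?_ (fun i => ?_) i
    · exact hr x hx
    · intro h1
      simp only [Φ, Fin.cons_succ]
      linarith [(abs_le.1 (hsmall x i)).1]) (by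
    intro x hx i
    refine Fin.cases ?_ (fun i => ?_) i
    · exact hl x hx
    · intro h1
      simp only [Φ, Fin.cons_succ]
      linarith [(abs_le.1 (hsmall x i)).2])
  have hcoord : ∀ i, Φ x i = 0 := fun i => by rw [hx0]; rfl
  have hxZ : x ∈ Z := ⟨hx, hcoord 0⟩
  refine hcψ ⟨⟨x, hxZ⟩, ?_⟩
  ext i
  have h1 := hcoord i.succ
  have h2 : T x i = ψ ⟨x, hxZ⟩ i - x i.succ := congrArg (fun y : E m => y i) (hTZ ⟨x, hxZ⟩)
  simp only [Φ, Fin.cons_succ] at h1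
  linarith

/-- A thin tube around a prescribed direction, parametrized by the cube. -/
theorem exists_injective_tube {m : ℕ} {v : E (m + 1)} (hv : v ≠ 0) {η : ℝ} (hη : 0 < η) :
    ∃ L : E (m + 1) → E (m + 1), Continuous L ∧ Function.Injective L ∧
      ∀ z ∈ cube (m + 1), ‖L z - z 0 • v‖ < η := by
  let e : E (m + 1) := EuclideanSpace.single 0 1
  have hvn : 0 < ‖v‖ := norm_pos_iff.2 hv
  -- A reflection interchanges two vectors of equal norm.
  obtain ⟨ρ, hρ⟩ : ∃ ρ : E (m + 1) ≃ₗᵢ[ℝ] E (m + 1), ρ (‖v‖ • e) = v :=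
    ⟨_, Submodule.reflection_sub (by simp [e, norm_smul])⟩
  have hcont : Continuous fun z : E (m + 1) => z - z 0 • e := by fun_prop
  obtain ⟨C, hC⟩ := (isCompact_cube (m + 1)).exists_bound_of_continuousOn hcont.continuousOn
  have hC0 : 0 ≤ C := (norm_nonneg _).trans (hC _ (clamp_mem_cube 0))
  let s : ℝ := η / (C + 1)
  have hs : 0 < s := by positivity
  refine ⟨fun z => ρ (z 0 • ‖v‖ • e + s • (z - z 0 • e)), by fun_prop, ?_, ?_⟩
  · intro z z' h
    have h := ρ.injective h
    ext i
    have hi := congrArg (fun y : E (m + 1) => y i) h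
    refine Fin.cases (motive := fun i => (z 0 • ‖v‖ • e + s • (z - z 0 • e)) i =
      (z' 0 • ‖v‖ • e + s • (z' - z' 0 • e)) i → z i = z' i) ?_ (fun j => ?_) i hi
    · simp [e, hvn.ne']
    · simp [e, hs.ne']
  · intro z hz
    beta_reduce
    rw [map_add, map_smul, hρ, add_sub_cancel_left, LinearIsometryEquiv.norm_map, norm_smul,
      Real.norm_eq_abs, abs_of_pos hs]
    calc s * ‖z - z 0 • e‖ ≤ s * C := by gcongr; exact hC z hz
      _ < η := by
        simp only [s]
        rw [div_mul_eq_mul_div, div_lt_iff₀ (by positivity)]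
        nlinarith

/-- If a continuous function `g` changes sign on a domain, then the image of its zero set under a
finite-to-one continuous map has positive Hausdorff measure of codimension one. -/
theorem euclideanHausdorffMeasure_image_zeros_ne_zero {m N : ℕ} {D : Set (E (m + 1))}
    (hD : IsOpen D) (hDc : IsPreconnected D) {f : E (m + 1) → E N} (hf : ContinuousOn f D)
    (hfin : ∀ y, {x | x ∈ D ∧ f x = y}.Finite) {g : E (m + 1) → ℝ} (hg : ContinuousOn g D)
    (hneg : ∃ x ∈ D, g x < 0) (hpos : ∃ x ∈ D, 0 < g x) :
    (μHE[m] : Measure (E N)) (f '' {x | x ∈ D ∧ g x = 0}) ≠ 0 := by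
  intro hnull
  have tube : ∀ A : E (m + 1) → E (m + 1), Continuous A → Function.Injective A →
      (∀ z ∈ cube (m + 1), A z ∈ D) → ∀ h : E (m + 1) → ℝ, ContinuousOn h (cube (m + 1)) →
      (∀ z ∈ cube (m + 1), z 0 = -1 → h z ≤ 0) → (∀ z ∈ cube (m + 1), z 0 = 1 → 0 ≤ h z) →
      (∀ z ∈ cube (m + 1), h z = 0 → g (A z) = 0) → False := by
    intro A hA hinj hAD h hh hl hr hz
    refine cube_crossing (f := f ∘ A) (hf.comp hA.continuousOn hAD) (fun y => ?_) hh hl hr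
      (measure_mono_null ?_ hnull)
    · refine Set.Finite.of_finite_image (f := A) ((hfin y).subset ?_) hinj.injOn
      rintro _ ⟨z, ⟨hz, hzy⟩, rfl⟩
      exact ⟨hAD z hz, hzy⟩
    · rintro _ ⟨z, ⟨hzc, hz0⟩, rfl⟩
      exact ⟨A z, ⟨hAD z hzc, hz z hzc hz0⟩, rfl⟩
  set U : Set (E (m + 1)) := D ∩ g ⁻¹' Iio 0
  set V : Set (E (m + 1)) := D ∩ g ⁻¹' Ioi 0
  have hU : IsOpen U := hg.isOpen_inter_preimage hD isOpen_Iio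
  have hV : IsOpen V := hg.isOpen_inter_preimage hD isOpen_Ioi
  -- Otherwise `g` vanishes on a ball, and a small tube inside it with the first coordinate as
  -- separating function contradicts `cube_crossing`.
  have hcov : D ⊆ closure U ∪ closure V := by
    intro x hx
    rw [← closure_union]
    by_contra hn
    rw [Metric.mem_closure_iff] at hn
    push Not at hn
    obtain ⟨ε, hε, hn⟩ := hn
    obtain ⟨s, hs, hsD⟩ := Metric.isOpen_iff.1 hD x hx
    let t : ℝ := min ε s / 4
    have ht : 0 < t := by positivity
    obtain ⟨L, hLc, hLi, hL⟩ := exists_injective_tube (v := t • EuclideanSpace.single 0 1)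
      (by simp [ht.ne']) ht
    have hball : ∀ z ∈ cube (m + 1), dist x (x + L z) < min ε s := fun z hz => by
      have h1 := hL z hz
      have h2 : ‖z 0 • t • (EuclideanSpace.single 0 1 : E (m + 1))‖ ≤ t := by
        rw [norm_smul, norm_smul]
        simp only [PiLp.norm_single, norm_one, mul_one, Real.norm_eq_abs, abs_of_pos ht]
        exact mul_le_of_le_one_left ht.le (hz 0)
      rw [dist_self_add_right]
      have h3 := norm_le_norm_sub_add (L z) (z 0 • t • EuclideanSpace.single 0 1)
      have h4 : min ε s = 4 * t := by simp only [t]; ring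
      linarith
    have hAD : ∀ z ∈ cube (m + 1), x + L z ∈ D := fun z hz => hsD (by
      rw [Metric.mem_ball']
      exact (hball z hz).trans_le (min_le_right _ _))
    refine tube (fun z => x + L z) (by fun_prop) (fun z z' h => hLi (add_left_cancel h)) hAD
      (fun z => z 0) (by fun_prop) (fun z _ h => by simp [h]) (fun z _ h => by simp [h])
      fun z hz _ => ?_
    by_contra hne
    refine absurd (hn (x + L z) ?_) (not_le.2 ((hball z hz).trans_le (min_le_left _ _)))
    rcases lt_or_gt_of_ne hne with h | h
    · exact Or.inl ⟨hAD z hz, h⟩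
    · exact Or.inr ⟨hAD z hz, h⟩
  -- Near a common boundary point of the two sign regions a straight tube can join them without
  -- leaving a ball in `D`.
  obtain ⟨x₀, hx₀D, hx₀U, hx₀V⟩ := isPreconnected_closed_iff.1 hDc _ _ isClosed_closure
    isClosed_closure hcov
    (by obtain ⟨x, hx, hx0⟩ := hneg; exact ⟨x, hx, subset_closure ⟨hx, hx0⟩⟩)
    (by obtain ⟨x, hx, hx0⟩ := hpos; exact ⟨x, hx, subset_closure ⟨hx, hx0⟩⟩)
  obtain ⟨s, hs, hsD⟩ := Metric.isOpen_iff.1 hD x₀ hx₀D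
  obtain ⟨a, haB, haU⟩ := mem_closure_iff.1 hx₀U _ Metric.isOpen_ball (Metric.mem_ball_self hs)
  obtain ⟨b, hbB, hbV⟩ := mem_closure_iff.1 hx₀V _ Metric.isOpen_ball (Metric.mem_ball_self hs)
  obtain ⟨η₁, hη₁, ha⟩ := Metric.isOpen_iff.1 (Metric.isOpen_ball.inter hU) a ⟨haB, haU⟩
  obtain ⟨η₂, hη₂, hb⟩ := Metric.isOpen_iff.1 (Metric.isOpen_ball.inter hV) b ⟨hbB, hbV⟩
  have hab : a ≠ b := by
    rintro rfl
    exact lt_asymm (show g a < 0 from haU.2) hbV.2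
  obtain ⟨L, hLc, hLi, hL⟩ := exists_injective_tube (v := (1 / 2 : ℝ) • (b - a))
    (by simpa [sub_eq_zero] using hab.symm) (lt_min hη₁ hη₂)
  let w : E (m + 1) → E (m + 1) := fun z => L z - z 0 • (1 / 2 : ℝ) • (b - a)
  let A : E (m + 1) → E (m + 1) := fun z => (1 / 2 : ℝ) • (a + b) + L z
  have hA : ∀ z, A z = ((1 - z 0) / 2) • (a + w z) + ((1 + z 0) / 2) • (b + w z) := fun z => by
    simp only [A, w]
    module
  have haw : ∀ z ∈ cube (m + 1), a + w z ∈ Metric.ball x₀ s ∩ U := fun z hz => ha (by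
    rw [mem_ball_iff_norm, add_sub_cancel_left]
    exact (hL z hz).trans_le (min_le_left _ _))
  have hbw : ∀ z ∈ cube (m + 1), b + w z ∈ Metric.ball x₀ s ∩ V := fun z hz => hb (by
    rw [mem_ball_iff_norm, add_sub_cancel_left]
    exact (hL z hz).trans_le (min_le_right _ _))
  have hAD : ∀ z ∈ cube (m + 1), A z ∈ D := fun z hz => hsD (by
    have h0 := abs_le.1 (hz 0)
    rw [hA]
    exact convex_ball x₀ s (haw z hz).1 (hbw z hz).1 (by linarith) (by linarith) (by ring))
  have hAc : Continuous A := by fun_prop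
  refine tube A hAc (fun z z' h => hLi (add_left_cancel h)) hAD (fun z => g (A z))
    (hg.comp hAc.continuousOn hAD) (fun z hz h => ?_) (fun z hz h => ?_) fun z _ h => h
  · have : A z = a + w z := by rw [hA, h]; module
    rw [this]
    exact (haw z hz).2.2.le
  · have : A z = b + w z := by rw [hA, h]; module
    rw [this]
    exact (hbw z hz).2.2.le

theorem sphere_inter_image_ne_zero {m : ℕ} {D : Set (E (m + 1))} (hD : IsOpen D)
    (hDc : IsPreconnected D) {f : E (m + 1) → E (m + 1)} (hf : ContinuousOn f D)
    (hfin : ∀ y, {x | x ∈ D ∧ f x = y}.Finite) {y₀ : E (m + 1)} {r : ℝ}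
    (hlt : ∃ x ∈ D, dist (f x) y₀ < r) (hgt : ∃ x ∈ D, r < dist (f x) y₀) :
    (μHE[m] : Measure (E (m + 1))) (Metric.sphere y₀ r ∩ f '' D) ≠ 0 := by
  have h := euclideanHausdorffMeasure_image_zeros_ne_zero hD hDc hf hfin
    (g := fun x => dist (f x) y₀ - r) (by fun_prop)
    (by simpa [sub_neg] using hlt) (by simpa [sub_pos] using hgt)
  refine fun h0 => h (measure_mono_null ?_ h0)
  rintro _ ⟨x, ⟨hx, hx0⟩, rfl⟩
  exact ⟨by rw [Metric.mem_sphere]; linarith, x, hx, rfl⟩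

end InverseKI

/-! ### Distortion of area on spheres under the inverse of a nearly linear map -/

namespace InverseKI

section HyperplaneJacobian

open Module

variable {V : Type*} [NormedAddCommGroup V] [InnerProductSpace ℝ V] [FiniteDimensional ℝ V]

theorem exists_orthonormalBasis_extending_hyperplane {m : ℕ} (hV : finrank ℝ V = m + 1)
    {H : Submodule ℝ V} (bH : OrthonormalBasis (Fin m) ℝ H) :
    ∃ b : OrthonormalBasis (Fin (m + 1)) ℝ V, ∀ j : Fin m, b j.succ = bH j := by
  let v : Fin (m + 1) → V := Fin.cons 0 fun j => (bH j : V)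
  have hv : Orthonormal ℝ ((range (Fin.succ : Fin m → Fin (m + 1))).domRestrict v) := by
    have h0 : Orthonormal ℝ fun j => (bH j : V) :=
      bH.orthonormal.comp_linearIsometry H.subtypeₗᵢ
    constructor
    · rintro ⟨_, j, rfl⟩
      exact h0.1 j
    · rintro ⟨_, j, rfl⟩ ⟨_, k, rfl⟩ hjk
      exact h0.2 fun h : j = k => hjk (by subst h; rfl)
  obtain ⟨b, hb⟩ := hv.exists_orthonormalBasis_extension_of_card_eq (by simpa using hV)
  exact ⟨b, fun j => hb _ ⟨j, rfl⟩⟩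

omit [FiniteDimensional ℝ V] in
theorem inner_orthonormalBasis_zero_eq_zero {m : ℕ} {H : Submodule ℝ V}
    (bH : OrthonormalBasis (Fin m) ℝ H) {b : OrthonormalBasis (Fin (m + 1)) ℝ V}
    (hb : ∀ j : Fin m, b j.succ = bH j) {x : V} (hx : x ∈ H) : inner ℝ (b 0) x = 0 := by
  have h := congrArg (Subtype.val : H → V) (bH.sum_repr' ⟨x, hx⟩)
  simp only [AddSubmonoidClass.coe_finsetSum, Submodule.coe_smul] at h
  rw [← h, inner_sum]
  refine Finset.sum_eq_zero fun j _ => ?_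
  rw [inner_smul_right, ← hb j, b.inner_eq_zero (Fin.succ_ne_zero j).symm, mul_zero]

/-- The area factor of a linear isomorphism `B` on a hyperplane is at most `|det B| ‖B⁻¹‖`. -/
theorem normDet_domRestrict_hyperplane_le {m : ℕ} (hV : finrank ℝ V = m + 1) (B : V ≃L[ℝ] V)
    {H : Submodule ℝ V} (hH : finrank ℝ H = m) :
    ((B : V →ₗ[ℝ] V).domRestrict H).normDet ≤
      ‖(B.symm : V →L[ℝ] V)‖ * |((B : V →L[ℝ] V)).det| := by
  let L : Submodule ℝ V := H.map (B : V →ₗ[ℝ] V)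
  have hL : finrank ℝ L = m := by
    rw [← hH]
    exact LinearEquiv.finrank_map_eq B.toLinearEquiv H
  let bH : OrthonormalBasis (Fin m) ℝ H := (stdOrthonormalBasis ℝ H).reindex (finCongr hH)
  let bL : OrthonormalBasis (Fin m) ℝ L := (stdOrthonormalBasis ℝ L).reindex (finCongr hL)
  obtain ⟨b₁, hb₁⟩ := exists_orthonormalBasis_extending_hyperplane hV bH
  obtain ⟨b₂, hb₂⟩ := exists_orthonormalBasis_extending_hyperplane hV bL
  let M := LinearMap.toMatrix b₁.toBasis b₂.toBasis (B : V →ₗ[ℝ] V)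
  have hM : ∀ i j, M i j = inner ℝ (b₂ i) (B (b₁ j)) := fun i j => by
    simp [M, LinearMap.toMatrix_apply, OrthonormalBasis.repr_apply_apply]
  have hMem : ∀ h ∈ H, B h ∈ L := fun h hh => ⟨h, hh, rfl⟩
  have hM0 : ∀ j : Fin m, M 0 j.succ = 0 := fun j => by
    rw [hM]
    exact inner_orthonormalBasis_zero_eq_zero bL hb₂ (hMem _ (by rw [hb₁]; exact (bH j).2))
  have hdet : M.det = M 0 0 * (M.submatrix Fin.succ Fin.succ).det := by
    rw [Matrix.det_succ_row_zero, Fin.sum_univ_succ]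
    simp [hM0, Fin.succAbove_zero]
  have hB : |((B : V →L[ℝ] V)).det| = |M.det| := by
    have := LinearMap.normDet_eq_norm_det_toMatrix (B : V →ₗ[ℝ] V) b₁ b₂
    rw [LinearMap.normDet_eq_abs_det] at this
    exact this
  have hsub : ((B : V →ₗ[ℝ] V).domRestrict H).normDet = |(M.submatrix Fin.succ Fin.succ).det| := by
    have hc : ∀ c : H, (B : V →ₗ[ℝ] V).domRestrict H c ∈ L := fun c => hMem c c.2
    rw [← LinearMap.normDet_codRestrict hc, LinearMap.normDet_eq_norm_det_toMatrix _ bH bL,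
      Real.norm_eq_abs]
    congr 2
    ext i j
    rw [Matrix.submatrix_apply, hM, hb₁, hb₂]
    simp [LinearMap.toMatrix_apply, OrthonormalBasis.repr_apply_apply]
  -- The first row of `M` is zero off the corner, so `a` is the inverse of the corner entry, and |a|
  -- ≤ ‖B⁻¹‖.
  set a : ℝ := inner ℝ (b₁ 0) (B.symm (b₂ 0)) with ha
  have hMa : M 0 0 * a = 1 := by
    have h1 : b₂ 0 = ∑ i, inner ℝ (b₁ i) (B.symm (b₂ 0)) • B (b₁ i) := by
      conv_lhs => rw [← B.apply_symm_apply (b₂ 0), ← b₁.sum_repr' (B.symm (b₂ 0))]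
      simp [map_sum]
    have h2 : (1 : ℝ) = inner ℝ (b₂ 0) (b₂ 0) := by
      rw [real_inner_self_eq_norm_sq, b₂.norm_eq_one]; norm_num
    rw [h2]
    conv_rhs => rw [h1, inner_sum]
    conv_rhs => rw [Fin.sum_univ_succ]
    have h3 : ∀ j : Fin m, inner ℝ (b₂ 0) (B (b₁ j.succ)) = 0 := fun j => by
      rw [← hM]; exact hM0 j
    simp only [← h1, inner_smul_right, h3, mul_zero, Finset.sum_const_zero, add_zero, ← hM]
    rw [mul_comm]
  have ha' : |a| ≤ ‖(B.symm : V →L[ℝ] V)‖ := by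
    refine (abs_real_inner_le_norm _ _).trans ?_
    rw [b₁.norm_eq_one, one_mul]
    refine ((B.symm : V →L[ℝ] V).le_opNorm (b₂ 0)).trans ?_
    rw [b₂.norm_eq_one, mul_one]
  rw [hsub, hB, hdet, abs_mul, ← mul_assoc]
  have h4 : |M 0 0| * |a| = 1 := by rw [← abs_mul, hMa, abs_one]
  have h5 : 1 ≤ ‖(B.symm : V →L[ℝ] V)‖ * |M 0 0| := by
    rw [← h4, mul_comm]
    exact mul_le_mul_of_nonneg_right ha' (abs_nonneg _)
  exact le_mul_of_one_le_left (abs_nonneg _) h5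

end HyperplaneJacobian

theorem euclideanHausdorffMeasure_image_le {X Y : Type*} [EMetricSpace X] [MeasurableSpace X]
    [BorelSpace X] [EMetricSpace Y] [MeasurableSpace Y] [BorelSpace Y] {d : ℕ} {K : NNReal}
    {f : X → Y} {s : Set X} (hf : LipschitzOnWith K f s) :
    (μHE[d] : Measure Y) (f '' s) ≤ (K : ℝ≥0∞) ^ d * (μHE[d] : Measure X) s := by
  simp only [Measure.euclideanHausdorffMeasure_def, Measure.smul_apply, ENNReal.smul_def,
    smul_eq_mul]
  rw [mul_left_comm]
  gcongr
  simpa using hf.hausdorffMeasure_image_le (d := d) (by positivity)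

theorem le_euclideanHausdorffMeasure_image {X Y : Type*} [MetricSpace X] [MeasurableSpace X]
    [BorelSpace X] [MetricSpace Y] [MeasurableSpace Y] [BorelSpace Y] {d : ℕ} {K : NNReal}
    {f : X → Y} {s : Set X} (hf : ∀ x ∈ s, ∀ y ∈ s, dist x y ≤ K * dist (f x) (f y)) :
    (μHE[d] : Measure X) s ≤ (K : ℝ≥0∞) ^ d * (μHE[d] : Measure Y) (f '' s) := by
  have hinj : InjOn f s := fun x hx y hy hxy => by
    have := hf x hx y hy
    rw [hxy, dist_self, mul_zero] at this
    exact dist_le_zero.1 this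
  rcases s.eq_empty_or_nonempty with rfl | ⟨x₀, hx₀⟩
  · simp
  have : Nonempty X := ⟨x₀⟩
  have hL : LipschitzOnWith K (Function.invFunOn f s) (f '' s) := by
    refine LipschitzOnWith.of_dist_le_mul ?_
    rintro _ ⟨x, hx, rfl⟩ _ ⟨y, hy, rfl⟩
    rw [hinj.leftInvOn_invFunOn hx, hinj.leftInvOn_invFunOn hy]
    exact hf x hx y hy
  have := euclideanHausdorffMeasure_image_le (d := d) hL
  rwa [hinj.leftInvOn_invFunOn.image_image] at this

/-! ### Area of preimages of spherical sets under nearly linear maps -/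

section NearlyLinear

variable {m : ℕ}

local notation "V" => E (m + 1)

/-- A chord `y - y'` is orthogonal to `(y - y₀) + (y' - y₀)`, which differs from `2 (y₁ - y₀)` by at
most 2κ; so chords near `y₁` are almost tangent there. -/
theorem norm_sub_starProjection_le_of_mem_sphere {y₀ y₁ y y' : V} {r κ : ℝ} (hr : 0 < r)
    (hy₁ : y₁ ∈ Metric.sphere y₀ r) (hy : y ∈ Metric.sphere y₀ r) (hy' : y' ∈ Metric.sphere y₀ r)
    (hyκ : dist y y₁ ≤ κ) (hyκ' : dist y' y₁ ≤ κ) :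
    ‖(y - y') - (ℝ ∙ (y₁ - y₀))ᗮ.starProjection (y - y')‖ ≤ κ / r * ‖y - y'‖ := by
  rw [Submodule.starProjection_orthogonal_val, sub_sub_cancel, Submodule.starProjection_singleton,
    norm_smul]
  rw [mem_sphere_iff_norm] at hy₁ hy hy'
  rw [dist_eq_norm] at hyκ hyκ'
  have h0 : inner ℝ (y - y') ((y - y₀) + (y' - y₀)) = 0 := by
    have : y - y' = (y - y₀) - (y' - y₀) := by abel
    rw [this, inner_sub_left, inner_add_right, inner_add_right, real_inner_self_eq_norm_sq,
      real_inner_self_eq_norm_sq, hy, hy', real_inner_comm]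
    ring
  have h1 : inner ℝ (y₁ - y₀) (y - y') = -(1 / 2) * inner ℝ (y - y') ((y - y₁) + (y' - y₁)) := by
    have : (y - y₀) + (y' - y₀) = ((y - y₁) + (y' - y₁)) + (2 : ℝ) • (y₁ - y₀) := by module
    rw [this, inner_add_right, inner_smul_right, real_inner_comm (y₁ - y₀) (y - y')] at h0
    linarith
  have h2 : |inner ℝ (y₁ - y₀) (y - y')| ≤ κ * ‖y - y'‖ := by
    rw [h1, abs_mul]
    have h3 := abs_real_inner_le_norm (y - y') ((y - y₁) + (y' - y₁))
    have h4 : ‖(y - y₁) + (y' - y₁)‖ ≤ 2 * κ := (norm_add_le _ _).trans (by linarith)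
    have h5 : |(-(1 / 2) : ℝ)| = 1 / 2 := by norm_num
    rw [h5]
    nlinarith [norm_nonneg (y - y')]
  rw [hy₁, Real.norm_eq_abs, abs_div]
  have h6 : |((r ^ 2 : ℝ))| = r * r := by rw [abs_of_pos (by positivity)]; ring
  simp only [RCLike.ofReal_real_eq_id, id]
  rw [h6, div_mul_eq_mul_div, div_le_iff₀ (by positivity)]
  have : κ / r * ‖y - y'‖ * (r * r) = κ * ‖y - y'‖ * r := by field_simp
  rw [this]
  gcongr

/-- Project f(W) to the tangent hyperplane at `y₁`, then apply A⁻¹. The composite moves differences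
in W by a relative error of at most θ, so it shrinks distances by no more than 1 - θ. The projection
does not increase area, and A⁻¹ scales area on the hyperplane by at most ‖A‖/|det A|. -/
theorem measure_le_of_image_subset_sphere_ball {f : V → V} {s : Set V} {A : V ≃L[ℝ] V}
    {δ : NNReal} (hf : ApproximatesLinearOn f (A : V →L[ℝ] V) s δ) {y₀ y₁ : V} {r κ θ : ℝ}
    (hr : 0 < r) (hκ : 0 < κ) (hθ : θ < 1)
    (hκθ : ‖(A.symm : V →L[ℝ] V)‖ * (δ + κ / r * (‖(A : V →L[ℝ] V)‖ + δ)) ≤ θ)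
    (hy₁ : y₁ ∈ Metric.sphere y₀ r) {W : Set V} (hWs : W ⊆ s)
    (hW : f '' W ⊆ Metric.sphere y₀ r ∩ Metric.ball y₁ κ) :
    (μHE[m] : Measure V) W ≤ ENNReal.ofReal ((1 - θ)⁻¹ ^ m *
      (‖(A : V →L[ℝ] V)‖ / |((A : V →L[ℝ] V)).det|)) * (μHE[m] : Measure V) (f '' W) := by
  set H : Submodule ℝ V := (ℝ ∙ (y₁ - y₀))ᗮ with hHdef
  have hH : Module.finrank ℝ H = m := by
    have : Fact (Module.finrank ℝ V = m + 1) := ⟨by simp⟩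
    refine Submodule.finrank_orthogonal_span_singleton fun h => ?_
    rw [mem_sphere_iff_norm, h, norm_zero] at hy₁
    exact hr.ne hy₁
  let P := H.orthogonalProjectionOnto
  let B : H →ₗ[ℝ] V := (A.symm : V →ₗ[ℝ] V).domRestrict H
  have hK : 0 ≤ (1 - θ)⁻¹ := inv_nonneg.2 (sub_nonneg.2 hθ.le)
  have hanti : ∀ x ∈ W, ∀ x' ∈ W, dist x x' ≤ (⟨(1 - θ)⁻¹, hK⟩ : NNReal) *
      dist (B (P (f x))) (B (P (f x'))) := by
    intro x hx x' hx'
    have hfx := hW ⟨x, hx, rfl⟩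
    have hfx' := hW ⟨x', hx', rfl⟩
    have h1 := norm_sub_starProjection_le_of_mem_sphere hr hy₁ hfx.1 hfx'.1
      (Metric.mem_ball.1 hfx.2).le (Metric.mem_ball.1 hfx'.2).le
    have h2 := hf x (hWs hx) x' (hWs hx')
    have h3 : ‖f x - f x'‖ ≤ (‖(A : V →L[ℝ] V)‖ + δ) * ‖x - x'‖ := by
      have h := norm_le_norm_sub_add (f x - f x') (A (x - x'))
      have h' := (A : V →L[ℝ] V).le_opNorm (x - x')
      simp only [ContinuousLinearEquiv.coe_coe] at h' h2
      linarith
    have h4 : B (P (f x)) - B (P (f x')) = (x - x') +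
        (A.symm : V →L[ℝ] V) ((f x - f x' - A (x - x')) -
          ((f x - f x') - H.starProjection (f x - f x'))) := by
      rw [← map_sub, ← map_sub]
      have : B (P (f x - f x')) = A.symm (H.starProjection (f x - f x')) := rfl
      rw [this]
      simp only [ContinuousLinearEquiv.coe_coe, map_sub, ContinuousLinearEquiv.symm_apply_apply]
      abel
    have h5 : ‖(A.symm : V →L[ℝ] V) ((f x - f x' - A (x - x')) -
          ((f x - f x') - H.starProjection (f x - f x')))‖ ≤ θ * ‖x - x'‖ := by
      refine ((A.symm : V →L[ℝ] V).le_opNorm _).trans ?_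
      have h6 : ‖(f x - f x' - A (x - x')) - ((f x - f x') - H.starProjection (f x - f x'))‖ ≤
          (δ + κ / r * (‖(A : V →L[ℝ] V)‖ + δ)) * ‖x - x'‖ := by
        refine (norm_sub_le _ _).trans ?_
        rw [add_mul, mul_assoc (κ / r)]
        refine add_le_add h2 (h1.trans ?_)
        gcongr
      refine (mul_le_mul_of_nonneg_left h6 (norm_nonneg _)).trans ?_
      rw [← mul_assoc]
      gcongr
    rw [dist_eq_norm, dist_eq_norm, h4]
    have h7 := norm_sub_le_norm_add (x - x') ((A.symm : V →L[ℝ] V) ((f x - f x' - A (x - x')) -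
          ((f x - f x') - H.starProjection (f x - f x'))))
    have h8 : 0 < 1 - θ := sub_pos.2 hθ
    change ‖x - x'‖ ≤ (1 - θ)⁻¹ * _
    rw [inv_mul_eq_div, le_div_iff₀ h8]
    linarith
  have hmain := le_euclideanHausdorffMeasure_image (d := m) hanti
  have himg : (fun x => B (P (f x))) '' W = B '' (P '' (f '' W)) := by
    simp only [image_image]
  have hB := LinearMap.euclideanHausdorffMeasure_image B (P '' (f '' W))
  rw [hH] at hB
  have hP := euclideanHausdorffMeasure_image_le (d := m)
    (H.lipschitzWith_orthogonalProjectionOnto.lipschitzOnWith (s := f '' W))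
  rw [ENNReal.coe_one, one_pow, one_mul] at hP
  have hdet : B.normDet ≤ ‖(A : V →L[ℝ] V)‖ / |((A : V →L[ℝ] V)).det| := by
    have := normDet_domRestrict_hyperplane_le (by simp) A.symm hH
    rwa [ContinuousLinearEquiv.symm_symm, ContinuousLinearEquiv.det_coe_symm, abs_inv,
      ← div_eq_mul_inv] at this
  refine hmain.trans ?_
  change _ * (μHE[m] : Measure V) ((fun x => B (P (f x))) '' W) ≤ _
  rw [himg, hB, ENNReal.ofReal_mul (by positivity), ENNReal.ofReal_pow hK, mul_assoc]
  gcongr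
  · exact (ENNReal.ofReal_eq_coe_nnreal hK).ge

/-- On a set where `f` is close to a linear isomorphism `A`, preimages of subsets of a sphere have
area at most about `‖A‖ / |det A|` times the area of the subset. -/
theorem measure_le_of_image_subset_sphere {f : V → V} {s : Set V} {A : V ≃L[ℝ] V}
    {δ : NNReal} (hf : ApproximatesLinearOn f (A : V →L[ℝ] V) s δ) {θ : ℝ} (hθ : θ < 1)
    (hδθ : ‖(A.symm : V →L[ℝ] V)‖ * δ < θ) {y₀ : V} {r : ℝ} (hr : 0 < r)
    {W : Set V} (hWs : W ⊆ s) (hW : f '' W ⊆ Metric.sphere y₀ r) :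
    (μHE[m] : Measure V) W ≤ ENNReal.ofReal ((1 - θ)⁻¹ ^ m *
      (‖(A : V →L[ℝ] V)‖ / |((A : V →L[ℝ] V)).det|)) * (μHE[m] : Measure V) (f '' W) := by
  obtain ⟨κ, hκ, hκθ⟩ : ∃ κ > 0,
      ‖(A.symm : V →L[ℝ] V)‖ * (δ + κ / r * (‖(A : V →L[ℝ] V)‖ + δ)) ≤ θ := by
    have hc : Continuous fun κ : ℝ =>
        ‖(A.symm : V →L[ℝ] V)‖ * (δ + κ / r * (‖(A : V →L[ℝ] V)‖ + δ)) := by fun_prop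
    have h0 := (hc.tendsto 0).eventually_lt_const (u := θ) (by simpa using hδθ)
    obtain ⟨κ, h1, h2⟩ := ((h0.filter_mono nhdsWithin_le_nhds).and
      (self_mem_nhdsWithin (a := (0 : ℝ)) (s := Ioi 0))).exists
    exact ⟨κ, h2, h1.le⟩
  obtain ⟨t, hts, htf, htc⟩ := (isCompact_sphere y₀ r).finite_cover_balls hκ
  rcases W.eq_empty_or_nonempty with rfl | ⟨x, hx⟩
  · simp
  have htne : t.Nonempty := by
    obtain ⟨y, hy, -⟩ := mem_iUnion₂.1 (htc (hW ⟨x, hx, rfl⟩))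
    exact ⟨y, hy⟩
  obtain ⟨u, hu⟩ := htf.countable.exists_eq_range htne
  -- Disjoint measurable pieces of the target let the areas be summed through a restricted measure
  -- although `W` and its image need not be measurable.
  let S : ℕ → Set V := disjointed fun i => Metric.ball (u i) κ
  have hSm : ∀ i, MeasurableSet (S i) := fun i =>
    MeasurableSet.disjointed (fun _ => Metric.isOpen_ball.measurableSet) i
  set c := ENNReal.ofReal ((1 - θ)⁻¹ ^ m * (‖(A : V →L[ℝ] V)‖ / |((A : V →L[ℝ] V)).det|))
  have hcov : W ⊆ ⋃ i, W ∩ f ⁻¹' S i := by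
    intro x hx
    obtain ⟨y, hy, hxy⟩ := mem_iUnion₂.1 (htc (hW ⟨x, hx, rfl⟩))
    rw [hu] at hy
    obtain ⟨i, rfl⟩ := hy
    have : f x ∈ ⋃ i, S i := by
      rw [iUnion_disjointed]
      exact mem_iUnion.2 ⟨i, hxy⟩
    obtain ⟨j, hj⟩ := mem_iUnion.1 this
    exact mem_iUnion.2 ⟨j, hx, hj⟩
  calc (μHE[m] : Measure V) W ≤ ∑' i, (μHE[m] : Measure V) (W ∩ f ⁻¹' S i) :=
        (measure_mono hcov).trans (measure_iUnion_le _)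
    _ ≤ ∑' i, c * (μHE[m] : Measure V) (f '' W ∩ S i) := by
        refine ENNReal.tsum_le_tsum fun i => ?_
        rw [← image_inter_preimage]
        refine measure_le_of_image_subset_sphere_ball hf hr hκ hθ hκθ
          (hts (hu ▸ mem_range_self i)) (inter_subset_left.trans hWs) ?_
        rw [image_inter_preimage]
        exact fun y hy => ⟨hW hy.1, disjointed_subset _ i hy.2⟩
    _ = c * ∑' i, (μHE[m] : Measure V).restrict (f '' W) (S i) := by
        rw [ENNReal.tsum_mul_left]
        simp_rw [Measure.restrict_apply (hSm _), inter_comm]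
    _ = c * (μHE[m] : Measure V).restrict (f '' W) (⋃ i, S i) := by
        rw [measure_iUnion (disjoint_disjointed _) hSm]
    _ ≤ c * (μHE[m] : Measure V) (f '' W) := by
        refine mul_le_mul' le_rfl ?_
        exact (measure_mono (subset_univ _)).trans_eq (Measure.restrict_apply_univ _)

end NearlyLinear

end InverseKI

namespace InverseKI

/-! ### Slices of null sets -/

theorem hausdorffMeasure_eq_zero_iff_euclideanHausdorffMeasure {X : Type*} [EMetricSpace X]
    [MeasurableSpace X] [BorelSpace X] {d : ℕ} {s : Set X} :
    (μHE[d] : Measure X) s = 0 ↔ (Measure.hausdorffMeasure d : Measure X) s = 0 := by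
  rw [Measure.euclideanHausdorffMeasure_def, Measure.smul_apply, ENNReal.smul_def, smul_eq_mul,
    mul_eq_zero, or_iff_right]
  simpa using Measure.addHaarScalarFactor_volume_hausdorffMeasure_ne_zero d

theorem exists_cover_tsum_ediam_lt {X : Type*} [EMetricSpace X] [MeasurableSpace X] [BorelSpace X]
    {d : ℝ} {s : Set X} (hs : (Measure.hausdorffMeasure d : Measure X) s = 0) {ε : ℝ≥0∞}
    (hε : 0 < ε) :
    ∃ t : ℕ → Set X, s ⊆ ⋃ n, t n ∧ (∀ n, Metric.ediam (t n) ≤ ε) ∧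
      ∑' n, ⨆ _ : (t n).Nonempty, Metric.ediam (t n) ^ d < ε := by
  rw [Measure.hausdorffMeasure_apply] at hs
  have h := (iSup₂_le_iff.1 hs.le ε hε).trans_lt hε
  simp only [iInf_lt_iff] at h
  obtain ⟨t, h1, h2, h3⟩ := h
  exact ⟨t, h1, h2, h3⟩

/-- Almost every level set of a `1`-Lipschitz function meets an `(m+1)`-dimensional null set in an
`m`-dimensional null set. -/
theorem ae_euclideanHausdorffMeasure_slice_eq_zero {X : Type*} [MetricSpace X] [MeasurableSpace X]
    [BorelSpace X] {m : ℕ} (hm : m ≠ 0) {Z : Set X} (hZ : (μHE[m + 1] : Measure X) Z = 0)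
    {u : X → ℝ} (hu : LipschitzWith 1 u) :
    ∀ᵐ r : ℝ, (μHE[m] : Measure X) (Z ∩ u ⁻¹' {r}) = 0 := by
  rw [hausdorffMeasure_eq_zero_iff_euclideanHausdorffMeasure] at hZ
  have hε : ∀ j : ℕ, (0 : ℝ≥0∞) < 2⁻¹ ^ j := fun j => ENNReal.pow_pos (by simp) j
  choose t hcov hdiam hsum using fun j => exists_cover_tsum_ediam_lt hZ (hε j)
  classical
  -- An interval of length twice the diameter of the covering set, containing its image under `u`.
  -- Integrating the m-th powers of diameters over levels thus yields (m+1)-st powers.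
  let I : ℕ → ℕ → Set ℝ := fun j n =>
    if h : (t j n).Nonempty then Metric.closedEBall (u h.some) (Metric.ediam (t j n)) else ∅
  have hI : ∀ j n, MeasurableSet (I j n) := fun j n => by
    by_cases h : (t j n).Nonempty
    · simp only [I, dif_pos h]; exact Metric.isClosed_closedEBall.measurableSet
    · simp only [I, dif_neg h]; exact MeasurableSet.empty
  let F : ℕ → ℝ → ℝ≥0∞ := fun j r => ∑' n, (I j n).indicator (fun _ => Metric.ediam (t j n) ^ m) r
  have hF : ∀ j, Measurable (F j) := fun j =>
    Measurable.tsum fun n => measurable_const.indicator (hI j n)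
  have hint : ∀ j, ∫⁻ r, F j r ≤ 2 * 2⁻¹ ^ j := fun j => by
    rw [lintegral_tsum fun n => (measurable_const.indicator (hI j n)).aemeasurable]
    refine le_trans ?_ (mul_le_mul' le_rfl (hsum j).le)
    rw [← ENNReal.tsum_mul_left]
    refine ENNReal.tsum_le_tsum fun n => ?_
    rw [lintegral_indicator_const (hI j n)]
    by_cases h : (t j n).Nonempty
    · simp only [I, dif_pos h, Real.volume_closedEBall, h, ciSup_pos, ENNReal.rpow_natCast, pow_succ]
      rw [mul_left_comm]
    · simp [I, dif_neg h]
  -- Summability over j forces F j r → 0 for almost every r, and `F j r` dominates the m-dimensional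
  -- cover sum of the slice.
  have htot : ∫⁻ r, ∑' j, F j r ≠ ∞ := by
    rw [lintegral_tsum fun j => (hF j).aemeasurable]
    refine ne_top_of_le_ne_top ?_ (ENNReal.tsum_le_tsum hint)
    rw [ENNReal.tsum_mul_left, ENNReal.tsum_geometric, ENNReal.one_sub_inv_two, inv_inv]
    exact ENNReal.mul_ne_top (by simp) (by simp)
  filter_upwards [ae_lt_top (Measurable.tsum hF) htot] with r hr
  rw [hausdorffMeasure_eq_zero_iff_euclideanHausdorffMeasure]
  have h0 := ENNReal.tendsto_atTop_zero_of_tsum_ne_top hr.ne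
  have hle := Measure.hausdorffMeasure_le_liminf_tsum (l := Filter.atTop) (m : ℝ)
    (Z ∩ u ⁻¹' {r}) (fun j : ℕ => 2⁻¹ ^ j)
    (ENNReal.tendsto_pow_atTop_nhds_zero_of_lt_one (by simp))
    (fun j n => t j n ∩ u ⁻¹' {r})
    (Filter.Eventually.of_forall fun j n => (Metric.ediam_mono inter_subset_left).trans (hdiam j n))
    (Filter.Eventually.of_forall fun j => by
      rw [← iUnion_inter]
      exact inter_subset_inter_left _ (hcov j))
  refine le_antisymm (hle.trans ?_) bot_le
  have hterm : ∀ j, ∑' n, Metric.ediam (t j n ∩ u ⁻¹' {r}) ^ (m : ℝ) ≤ F j r := fun j => by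
    refine ENNReal.tsum_le_tsum fun n => ?_
    rw [ENNReal.rpow_natCast]
    rcases (t j n ∩ u ⁻¹' {r}).eq_empty_or_nonempty with h | ⟨x, hx, hxr⟩
    · simp [h, hm]
    · have hne : (t j n).Nonempty := ⟨x, hx⟩
      have hrI : r ∈ I j n := by
        simp only [I, dif_pos hne, Metric.mem_closedEBall]
        rw [← show u x = r from hxr]
        have := hu x hne.some
        rw [ENNReal.coe_one, one_mul] at this
        exact this.trans (Metric.edist_le_ediam_of_mem hx hne.some_mem)
      rw [indicator_of_mem hrI]
      exact pow_le_pow_left' (Metric.ediam_mono inter_subset_left) m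
  refine (Filter.liminf_le_liminf (Filter.Eventually.of_forall hterm)).trans ?_
  rw [h0.liminf_eq]

/-- Polar coordinates reduce the integral of a radial indicator to one over radii. -/
theorem volume_preimage_dist_eq_zero {m : ℕ} (y₀ : E (m + 1)) {N : Set ℝ} (hN : volume N = 0) :
    volume {y : E (m + 1) | dist y y₀ ∈ N} = 0 := by
  let M := toMeasurable volume N
  have hM : volume M = 0 := by rw [measure_toMeasurable, hN]
  have hMm : MeasurableSet M := measurableSet_toMeasurable _ _
  let g : ℝ → ℝ := M.indicator 1
  have h0 : (fun y : ℝ => y ^ (Module.finrank ℝ (E (m + 1)) - 1) • g y)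
      =ᵐ[volume.restrict (Ioi 0)] 0 := by
    refine ae_restrict_of_ae ?_
    filter_upwards [measure_eq_zero_iff_ae_notMem.1 hM] with y hy
    simp [g, hy]
  have hint : Integrable (fun x : E (m + 1) => g ‖x‖) volume := by
    rw [integrable_fun_norm_addHaar volume]
    exact (integrable_congr h0).2 (integrable_zero _ _ _)
  have hzero : ∫ x : E (m + 1), g ‖x‖ = 0 := by
    rw [integral_fun_norm_addHaar, integral_congr_ae h0]
    simp
  rw [integral_eq_zero_iff_of_nonneg (fun x => indicator_nonneg (by simp) _) hint] at hzero
  have hnorm : volume {x : E (m + 1) | ‖x‖ ∈ M} = 0 := by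
    rw [measure_eq_zero_iff_ae_notMem]
    filter_upwards [hzero] with x hx hxM
    have hxM : ‖x‖ ∈ M := hxM
    simp [hxM] at hx
  have hpre := measure_preimage_add_right volume (-y₀) {x : E (m + 1) | ‖x‖ ∈ M}
  rw [hnorm] at hpre
  refine measure_mono_null (fun y hy => ?_) hpre
  have hy : dist y y₀ ∈ N := hy
  rw [dist_eq_norm, sub_eq_add_neg] at hy
  exact subset_toMeasurable volume N hy

/-! ### Decomposition into pieces where the map is nearly linear -/

section Pieces

variable {m : ℕ}

local notation "V" => E (m + 1)

theorem norm_pos_of_det_ne_zero {A : V →L[ℝ] V} (hA : A.det ≠ 0) : 0 < ‖A‖ := by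
  rw [norm_pos_iff]
  rintro rfl
  refine hA ?_
  have : (0 : V →ₗ[ℝ] V).det = 0 := by
    rw [LinearMap.det_zero]
    simp
  exact this

/-- The margin τ is split at σ: θ, independent of `A`, uses up σ, and continuity of ‖B‖/|det B| at
`A` supplies the rest through δ. -/
theorem exists_linear_approx_constants (m : ℕ) {τ : ℝ} (hτ : 1 < τ) : ∃ θ : ℝ, θ < 1 ∧
    ∀ A : E (m + 1) →L[ℝ] E (m + 1), ∃ δ : NNReal, δ ≠ 0 ∧ ∀ hA : A.det ≠ 0,
      ‖((A.toContinuousLinearEquivOfDetNeZero hA).symm : E (m + 1) →L[ℝ] E (m + 1))‖ * δ < θ ∧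
      ∀ B : E (m + 1) →L[ℝ] E (m + 1), ‖B - A‖₊ ≤ δ →
        (1 - θ)⁻¹ ^ m * (‖A‖ / |A.det|) ≤ τ * (‖B‖ / |B.det|) := by
  obtain ⟨σ, hσ1, hστ⟩ := exists_between hτ
  obtain ⟨θ, hθ0, hθ1, hθσ⟩ : ∃ θ : ℝ, 0 < θ ∧ θ < 1 ∧ (1 - θ)⁻¹ ^ m < σ := by
    have hc : ContinuousAt (fun θ : ℝ => (1 - θ)⁻¹ ^ m) 0 := by
      refine ContinuousAt.pow (ContinuousAt.inv₀ (by fun_prop) (by norm_num)) m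
    have h1 := hc.tendsto.eventually_lt_const (u := σ) (by simpa using hσ1)
    have h2 : ∀ᶠ θ : ℝ in nhdsWithin 0 (Ioi 0), θ < 1 ∧ (1 - θ)⁻¹ ^ m < σ :=
      ((eventually_lt_nhds one_pos).and h1).filter_mono nhdsWithin_le_nhds
    obtain ⟨θ, h3, h4⟩ := (h2.and self_mem_nhdsWithin).exists
    exact ⟨θ, h4, h3.1, h3.2⟩
  refine ⟨θ, hθ1, fun A => ?_⟩
  by_cases hA : A.det ≠ 0
  swap
  · exact ⟨1, one_ne_zero, fun h => absurd h hA⟩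
  set S := ((A.toContinuousLinearEquivOfDetNeZero hA).symm : E (m + 1) →L[ℝ] E (m + 1))
  have hw0 : 0 < ‖A‖ / |A.det| := div_pos (norm_pos_of_det_ne_zero hA) (abs_pos.2 hA)
  have hwc : ContinuousAt (fun B : E (m + 1) →L[ℝ] E (m + 1) => τ * (‖B‖ / |B.det|)) A :=
    continuousAt_const.mul (continuous_norm.continuousAt.div
      ContinuousLinearMap.continuous_det.abs.continuousAt (abs_ne_zero.2 hA))
  have hlt : σ * (‖A‖ / |A.det|) < τ * (‖A‖ / |A.det|) := mul_lt_mul_of_pos_right hστ hw0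
  obtain ⟨ρ, hρ, hB⟩ := Metric.eventually_nhds_iff.1 (hwc.tendsto.eventually_const_lt hlt)
  let δ : ℝ := min (ρ / 2) (θ / (2 * (‖S‖ + 1)))
  have hδ : 0 < δ := by positivity
  refine ⟨⟨δ, hδ.le⟩, fun h => hδ.ne' (congrArg NNReal.toReal h), fun _ => ⟨?_, fun B hBA => ?_⟩⟩
  · change ‖S‖ * δ < θ
    calc ‖S‖ * δ ≤ ‖S‖ * (θ / (2 * (‖S‖ + 1))) := by gcongr; exact min_le_right _ _
      _ < θ := by
        rw [← mul_div_assoc, div_lt_iff₀ (by positivity)]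
        nlinarith [norm_nonneg S]
  · have h1 : ‖B - A‖ ≤ δ := hBA
    have h2 : dist B A < ρ := by
      rw [dist_eq_norm]
      have := min_le_left (ρ / 2) (θ / (2 * (‖S‖ + 1)))
      linarith
    refine le_trans ?_ (hB h2).le
    gcongr

/-- The set of regular points of differentiability decomposes, up to a null set, into pieces on
which the map is injective and distorts area of spheres in a controlled way. -/
theorem exists_regular_pieces {f : V → V} {s : Set V} (hs : MeasurableSet s)
    (hd : ∀ x ∈ s, DifferentiableAt ℝ f x) (hdet : ∀ x ∈ s, (fderiv ℝ f x).det ≠ 0) {τ : ℝ}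
    (hτ : 1 < τ) :
    ∃ (P : ℕ → Set V) (c : ℕ → ℝ), Pairwise (Function.onFun Disjoint P) ∧
      (∀ k, MeasurableSet (P k)) ∧ (∀ k, P k ⊆ s) ∧ volume (s \ ⋃ k, P k) = 0 ∧
      (∀ k, InjOn f (P k)) ∧
      (∀ k, ∀ x ∈ P k, c k ≤ τ * (‖fderiv ℝ f x‖ / |(fderiv ℝ f x).det|)) ∧
      ∀ k (y₀ : V) (r : ℝ), 0 < r → ∀ W ⊆ P k, f '' W ⊆ Metric.sphere y₀ r →
        (μHE[m] : Measure V) W ≤ ENNReal.ofReal (c k) * (μHE[m] : Measure V) (f '' W) := by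
  rcases s.eq_empty_or_nonempty with rfl | hne
  · refine ⟨fun _ => ∅, fun _ => 0, fun i j _ => disjoint_bot_left, by simp, by simp, by simp,
      by simp, by simp, fun k y₀ r _ W hW _ => ?_⟩
    simp [subset_empty_iff.1 hW]
  obtain ⟨θ, hθ, hδ⟩ := exists_linear_approx_constants m hτ
  choose δ hδ0 hδA using hδ
  have hder : ∀ x ∈ s, HasFDerivWithinAt f (fderiv ℝ f x) s x := fun x hx =>
    (hd x hx).hasFDerivAt.hasFDerivWithinAt
  obtain ⟨t, A, htd, htm, hst, happ, hA⟩ :=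
    exists_partition_approximatesLinearOn_of_hasFDerivWithinAt f s (fderiv ℝ f) hder δ hδ0
  have hAdet : ∀ k, (A k).det ≠ 0 := fun k => by
    obtain ⟨y, hy, hyA⟩ := hA hne k
    rw [hyA]
    exact hdet y hy
  let e : ℕ → V ≃L[ℝ] V := fun k => (A k).toContinuousLinearEquivOfDetNeZero (hAdet k)
  have he : ∀ k, (e k : V →L[ℝ] V) = A k := fun k => by ext; rfl
  -- Linear approximation on `s ∩ t k` forces the derivative to be δ-close to `A k` at almost all
  -- its points, so this extra condition costs only a null set.
  let P : ℕ → Set V := fun k => s ∩ t k ∩ {x | ‖fderiv ℝ f x - A k‖₊ ≤ δ (A k)}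
  have hPs : ∀ k, P k ⊆ s ∩ t k := fun k => inter_subset_left
  have happ' : ∀ k, ApproximatesLinearOn f (e k : V →L[ℝ] V) (P k) (δ (A k)) := fun k => by
    rw [he]
    exact (happ k).mono_set (hPs k)
  refine ⟨P, fun k => (1 - θ)⁻¹ ^ m * (‖A k‖ / |(A k).det|), ?_, ?_, ?_, ?_, ?_, ?_, ?_⟩
  · exact fun i j hij => (htd hij).mono (fun x hx => (hPs i hx).2) fun x hx => (hPs j hx).2
  · exact fun k => (hs.inter (htm k)).inter (measurableSet_le
      ((measurable_fderiv ℝ f).sub_const _).nnnorm measurable_const)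
  · exact fun k => (hPs k).trans inter_subset_left
  · have hnull : ∀ k, volume {x ∈ s ∩ t k | ¬ ‖fderiv ℝ f x - A k‖₊ ≤ δ (A k)} = 0 := fun k => by
      have := (happ k).norm_fderiv_sub_le volume (hs.inter (htm k)) (fderiv ℝ f)
        fun x hx => (hd x hx.1).hasFDerivAt.hasFDerivWithinAt
      rw [ae_restrict_iff' (hs.inter (htm k)), ae_iff] at this
      refine measure_mono_null ?_ this
      exact fun x hx h => hx.2 (h hx.1)
    refine measure_mono_null (fun x hx => ?_) (measure_iUnion_null hnull)
    obtain ⟨k, hk⟩ := mem_iUnion.1 (hst hx.1)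
    exact mem_iUnion.2 ⟨k, ⟨hx.1, hk⟩, fun h => hx.2 (mem_iUnion.2 ⟨k, ⟨hx.1, hk⟩, h⟩)⟩
  · intro k
    refine (happ' k).injOn (Or.inr ?_)
    have h1 := ((hδA (A k) (hAdet k)).1).trans hθ
    rw [NNReal.lt_inv_iff_mul_lt (e k).nnnorm_symm_pos.ne', mul_comm, ← NNReal.coe_lt_coe]
    exact h1
  · exact fun k x hx => (hδA (A k) (hAdet k)).2 _ hx.2
  · intro k y₀ r hr W hW hWS
    have := measure_le_of_image_subset_sphere (happ' k) hθ (hδA (A k) (hAdet k)).1 hr hW hWS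
    rwa [he] at this

end Pieces

end InverseKI

namespace InverseKI

/-! ### Transfer of functions and integrals along the pieces -/

/-- A continuous injection of a Borel subset of a Polish space is a measurable embedding, so a Borel
function on `P` can be moved to the image and extended by zero. -/
theorem exists_measurable_transfer {X Y : Type*} [TopologicalSpace X] [PolishSpace X]
    [MeasurableSpace X] [BorelSpace X] [TopologicalSpace Y] [T2Space Y] [SecondCountableTopology Y]
    [MeasurableSpace Y] [BorelSpace Y] {f : X → Y} {P : Set X} (hP : MeasurableSet P)
    (hf : ContinuousOn f P) (hinj : InjOn f P) {φ : X → ℝ≥0∞} (hφ : Measurable φ) :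
    ∃ F : Y → ℝ≥0∞, Measurable F ∧ (∀ x ∈ P, F (f x) = φ x) ∧ ∀ y ∉ f '' P, F y = 0 := by
  have hemb : MeasurableEmbedding (P.domRestrict f) := hf.measurableEmbedding hP hinj
  refine ⟨Function.extend (P.domRestrict f) (fun x => φ x) 0,
    hemb.measurable_extend (hφ.comp measurable_subtype_coe) measurable_const, fun x hx => ?_,
    fun y hy => ?_⟩
  · exact hemb.injective.extend_apply (fun x : P => φ x) 0 ⟨x, hx⟩
  · refine Function.extend_apply' _ _ _ ?_
    rintro ⟨x, rfl⟩
    exact hy ⟨x, x.2, rfl⟩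

/-- The area bound on all subsets says that the pushforward of μ is dominated by `c • ν`, and
domination of measures passes to integrals. -/
theorem setLIntegral_comp_le_of_measure_le {X Y : Type*} [TopologicalSpace X] [MeasurableSpace X]
    [BorelSpace X] [TopologicalSpace Y] [MeasurableSpace Y] [BorelSpace Y]
    {μ : Measure X} {ν : Measure Y} {f : X → Y} {D P : Set X} (hD : IsOpen D)
    (hf : ContinuousOn f D) (hPD : P ⊆ D) (hP : MeasurableSet P) {S : Set Y} (hS : IsClosed S)
    {c : ℝ≥0∞} (hc : ∀ W ⊆ P, f '' W ⊆ S → μ W ≤ c * ν (f '' W)) {G : Y → ℝ≥0∞}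
    (hG : Measurable G) :
    MeasurableSet (P ∩ f ⁻¹' S) ∧
      ∫⁻ x in P ∩ f ⁻¹' S, G (f x) ∂μ ≤ c * ∫⁻ y in S ∩ f '' P, G y ∂ν := by
  have hmeas : MeasurableSet (P ∩ f ⁻¹' S) := by
    have : P ∩ f ⁻¹' S = P \ (D ∩ f ⁻¹' Sᶜ) := by
      ext x
      constructor
      · exact fun hx => ⟨hx.1, fun h => h.2 hx.2⟩
      · exact fun hx => ⟨hx.1, by_contra fun h => hx.2 ⟨hPD hx.1, h⟩⟩
    rw [this]
    exact hP.diff (hf.isOpen_inter_preimage hD hS.isOpen_compl).measurableSet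
  refine ⟨hmeas, ?_⟩
  have hfm : AEMeasurable f (μ.restrict (P ∩ f ⁻¹' S)) :=
    (hf.mono (inter_subset_left.trans hPD)).aemeasurable hmeas
  have hle : (μ.restrict (P ∩ f ⁻¹' S)).map f ≤ c • ν.restrict (S ∩ f '' P) := by
    refine Measure.le_iff.2 fun A hA => ?_
    rw [Measure.map_apply_of_aemeasurable hfm hA, Measure.smul_apply, Measure.restrict_apply hA,
      smul_eq_mul, Measure.restrict_apply₀' hmeas.nullMeasurableSet]
    refine (hc _ (inter_subset_right.trans inter_subset_left) ?_).trans ?_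
    · rintro _ ⟨x, hx, rfl⟩
      exact hx.2.2
    · gcongr
      rintro _ ⟨x, hx, rfl⟩
      exact ⟨hx.1, hx.2.2, x, hx.2.1, rfl⟩
  rw [← lintegral_map' hG.aemeasurable hfm]
  refine (lintegral_mono' hle le_rfl).trans_eq ?_
  rw [lintegral_smul_measure, smul_eq_mul]

section AreaFormula

variable {n : ℕ}

theorem lintegral_transfer_eq {f : E n → E n} {P : Set (E n)} (hP : MeasurableSet P)
    (hd : ∀ x ∈ P, DifferentiableAt ℝ f x) (hdet : ∀ x ∈ P, (fderiv ℝ f x).det ≠ 0)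
    (hinj : InjOn f P) {φ H : E n → ℝ≥0∞}
    (hH : ∀ x ∈ P, H (f x) = φ x * (ENNReal.ofReal |(fderiv ℝ f x).det|)⁻¹)
    (hH0 : ∀ y ∉ f '' P, H y = 0) :
    ∫⁻ y, H y = ∫⁻ x in P, φ x := by
  have hder : ∀ x ∈ P, HasFDerivWithinAt f (fderiv ℝ f x) P x := fun x hx =>
    (hd x hx).hasFDerivAt.hasFDerivWithinAt
  have hfP : MeasurableSet (f '' P) := measurable_image_of_fderivWithin hP hder hinj
  have h1 : ∫⁻ y, H y = ∫⁻ y in f '' P, H y := by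
    rw [← lintegral_indicator hfP]
    congr 1
    ext y
    by_cases hy : y ∈ f '' P
    · rw [indicator_of_mem hy]
    · rw [indicator_of_notMem hy, hH0 y hy]
  rw [h1, lintegral_image_eq_lintegral_abs_det_fderiv_mul volume hP hder hinj]
  refine setLIntegral_congr_fun hP fun x hx => ?_
  have h0 : ENNReal.ofReal |(fderiv ℝ f x).det| ≠ 0 := by simpa using hdet x hx
  beta_reduce
  rw [hH x hx, mul_left_comm, ENNReal.mul_inv_cancel h0 ENNReal.ofReal_ne_top, mul_one]

end AreaFormula

/-! ### Hölder's inequality over a fibre -/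

theorem tsum_mul_rpow_le {ι : Type*} {a b : ι → ℝ≥0∞} {q α : ℝ} (hqα : q.HolderConjugate α) :
    (∑' k, a k * b k) ^ q ≤ (∑' k, a k ^ q) * (∑' k, b k ^ α) ^ (q / α) := by
  let _ : MeasurableSpace ι := ⊤
  have h := ENNReal.lintegral_mul_le_Lp_mul_Lq (Measure.count : Measure ι) hqα
    (measurable_from_top (f := a)).aemeasurable (measurable_from_top (f := b)).aemeasurable
  simp only [lintegral_count, Pi.mul_apply] at h
  refine (ENNReal.rpow_le_rpow h hqα.nonneg).trans_eq ?_
  rw [ENNReal.mul_rpow_of_nonneg _ _ hqα.nonneg, ← ENNReal.rpow_mul, ← ENNReal.rpow_mul,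
    one_div_mul_cancel hqα.ne_zero, ENNReal.rpow_one]
  congr 2
  ring

theorem outerDilatation_eq {n : ℕ} {α : ℝ} (hα : 0 ≤ α) {f : E n → E n} {x : E n}
    (hdet : (fderiv ℝ f x).det ≠ 0) :
    outerDilatation α f x = ENNReal.ofReal ‖fderiv ℝ f x‖ ^ α *
      (ENNReal.ofReal |(fderiv ℝ f x).det|)⁻¹ := by
  have h0 := abs_pos.2 hdet
  rw [outerDilatation, if_pos hdet, ENNReal.ofReal_div_of_pos h0,
    ENNReal.ofReal_rpow_of_nonneg (norm_nonneg _) hα, div_eq_mul_inv]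

/-- The pointwise estimate behind the modulus inequality. -/
theorem tsum_transfer_rpow_le {n : ℕ} {q α τ : ℝ} (hqα : q.HolderConjugate α) (hτ : 0 ≤ τ)
    {f : E n → E n} {D : Set (E n)} {P : ℕ → Set (E n)} {c : ℕ → ℝ} {ρ : E n → ℝ≥0∞}
    {G H : ℕ → E n → ℝ≥0∞} (hPD : ∀ k, P k ⊆ D) (hdisj : Pairwise (Function.onFun Disjoint P))
    (hdet : ∀ k, ∀ x ∈ P k, (fderiv ℝ f x).det ≠ 0)
    (hc : ∀ k, ∀ x ∈ P k, c k ≤ τ * (‖fderiv ℝ f x‖ / |(fderiv ℝ f x).det|))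
    (hG : ∀ k, ∀ x ∈ P k, G k (f x) = ρ x) (hG0 : ∀ k, ∀ y ∉ f '' P k, G k y = 0)
    (hH : ∀ k, ∀ x ∈ P k, H k (f x) = ρ x ^ q * (ENNReal.ofReal |(fderiv ℝ f x).det|)⁻¹)
    (y : E n) :
    (∑' k, ENNReal.ofReal (c k) * G k y) ^ q ≤
      ENNReal.ofReal τ ^ q * (∑' k, H k y) * innerDilatationInv α f D y ^ (q / α) := by
  let I : Set ℕ := {k | y ∈ f '' P k}
  have hI : ∀ k : I, ∃ x ∈ P k, f x = y := fun k => k.2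
  choose x hxP hxy using hI
  let J : I → ℝ≥0∞ := fun k => ENNReal.ofReal |(fderiv ℝ f (x k)).det|
  let L : I → ℝ≥0∞ := fun k => ENNReal.ofReal ‖fderiv ℝ f (x k)‖
  have hdet' : ∀ k, (fderiv ℝ f (x k)).det ≠ 0 := fun k => hdet k _ (hxP k)
  have hJ0 : ∀ k, J k ≠ 0 := fun k => by simpa [J] using hdet' k
  have hJt : ∀ k, J k ≠ ∞ := fun k => ENNReal.ofReal_ne_top
  -- Splitting 1/J as J^(-1/q) J^(-1/α) makes a^q = ρ^q/J, the density for the change of variables,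
  -- and b^α the outer dilatation.
  let a : I → ℝ≥0∞ := fun k => ρ (x k) * J k ^ (-q⁻¹)
  let b : I → ℝ≥0∞ := fun k => L k * J k ^ (-α⁻¹)
  have hab : ∀ k, a k * b k = ρ (x k) * (L k * (J k)⁻¹) := fun k => by
    have : J k ^ (-q⁻¹) * J k ^ (-α⁻¹) = (J k)⁻¹ := by
      rw [← ENNReal.rpow_add _ _ (hJ0 k) (hJt k), ← neg_add, hqα.inv_add_inv_eq_one,
        ENNReal.rpow_neg_one]
    rw [← this]
    simp only [a, b]
    ring
  have ha : ∀ k, a k ^ q = H k y := fun k => by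
    rw [← hxy k, hH k _ (hxP k), ENNReal.mul_rpow_of_nonneg _ _ hqα.nonneg, ← ENNReal.rpow_mul,
      neg_mul, inv_mul_cancel₀ hqα.ne_zero, ENNReal.rpow_neg_one]
  have hb : ∀ k, b k ^ α = outerDilatation α f (x k) := fun k => by
    rw [outerDilatation_eq hqα.symm.nonneg (hdet' k),
      ENNReal.mul_rpow_of_nonneg _ _ hqα.symm.nonneg, ← ENNReal.rpow_mul, neg_mul,
      inv_mul_cancel₀ hqα.symm.ne_zero, ENNReal.rpow_neg_one]
  have hsum : ∑' k, ENNReal.ofReal (c k) * G k y ≤ ENNReal.ofReal τ * ∑' k, a k * b k := by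
    have h1 : ∑' k, ENNReal.ofReal (c k) * G k y = ∑' k : I, ENNReal.ofReal (c k) * G k y := by
      rw [tsum_subtype I fun k => ENNReal.ofReal (c k) * G k y]
      refine tsum_congr fun k => ?_
      by_cases hk : k ∈ I
      · rw [indicator_of_mem hk]
      · rw [indicator_of_notMem hk, hG0 k y hk, mul_zero]
    rw [h1, ← ENNReal.tsum_mul_left]
    refine ENNReal.tsum_le_tsum fun k => ?_
    have h2 : ENNReal.ofReal (c k) ≤ ENNReal.ofReal τ * (L k * (J k)⁻¹) := by
      rw [← div_eq_mul_inv, ← ENNReal.ofReal_div_of_pos (abs_pos.2 (hdet' k)),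
        ← ENNReal.ofReal_mul hτ]
      exact ENNReal.ofReal_le_ofReal (hc k _ (hxP k))
    have h3 : G k y = ρ (x k) := by rw [← hG k _ (hxP k), hxy]
    rw [hab, h3, mul_left_comm, mul_comm]
    gcongr
  -- Disjoint pieces give distinct points of the fibre, so no term of the inner dilatation is
  -- counted twice.
  have hxinj : Function.Injective x := fun j k hjk => by
    by_contra hne
    exact (hdisj fun h => hne (Subtype.ext h)).le_bot ⟨hxP j, hjk ▸ hxP k⟩
  have hQ : ∑' k, b k ^ α ≤ innerDilatationInv α f D y := by
    simp_rw [hb]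
    refine ENNReal.tsum_comp_le_tsum_of_injective (f := fun k : I =>
      (⟨x k, hPD k (hxP k), hxy k⟩ : {x : E n // x ∈ D ∧ f x = y})) (fun j k hjk => ?_)
      (fun x => outerDilatation α f x)
    exact hxinj (congrArg Subtype.val hjk)
  calc (∑' k, ENNReal.ofReal (c k) * G k y) ^ q
      ≤ (ENNReal.ofReal τ * ∑' k, a k * b k) ^ q := ENNReal.rpow_le_rpow hsum hqα.nonneg
    _ = ENNReal.ofReal τ ^ q * (∑' k, a k * b k) ^ q :=
        ENNReal.mul_rpow_of_nonneg _ _ hqα.nonneg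
    _ ≤ ENNReal.ofReal τ ^ q * ((∑' k, a k ^ q) * (∑' k, b k ^ α) ^ (q / α)) := by
        gcongr; exact tsum_mul_rpow_le hqα
    _ ≤ ENNReal.ofReal τ ^ q * ((∑' k, H k y) * innerDilatationInv α f D y ^ (q / α)) := by
        gcongr
        · simp_rw [ha]
          exact ENNReal.tsum_comp_le_tsum_of_injective Subtype.val_injective fun k => H k y
        · exact div_nonneg hqα.nonneg hqα.symm.nonneg
    _ = _ := (mul_assoc _ _ _).symm

end InverseKI

namespace InverseKI

/-! ### The modulus inequality -/

section Modulus

variable {m : ℕ}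

local notation "V" => E (m + 1)

theorem image_preimage_sphere (f : V → V) (D : Set V) (S : Set V) :
    f '' (D ∩ f ⁻¹' (S ∩ f '' D)) = S ∩ f '' D := by
  ext y
  constructor
  · rintro ⟨x, hx, rfl⟩
    exact hx.2
  · rintro ⟨hy, x, hx, rfl⟩
    exact ⟨x, ⟨hx, hy, x, hx, rfl⟩, rfl⟩

theorem finite_fiber_of_multiplicity_lt_top {n : ℕ} {f : E n → E n} {D : Set (E n)}
    (h : multiplicity f D < ⊤) (y : E n) : {x | x ∈ D ∧ f x = y}.Finite :=
  encard_lt_top_iff.1 ((le_iSup (fun y => {x | x ∈ D ∧ f x = y}.encard) y).trans_lt h)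

theorem one_le_multiplicity {n : ℕ} {f : E n → E n} {D : Set (E n)} (h : D.Nonempty) :
    1 ≤ multiplicity f D := by
  obtain ⟨x, hx⟩ := h
  refine le_trans ?_ (le_iSup (fun y => {x | x ∈ D ∧ f x = y}.encard) (f x))
  rw [one_le_encard_iff_nonempty]
  exact ⟨x, hx, rfl⟩

theorem sphere_inter_image_pos {D : Set V} (hD : IsOpen D) (hDc : IsConnected D) {f : V → V}
    (hf : ContinuousOn f D) (hmult : multiplicity f D < ⊤) {y₀ : V} (hy₀ : y₀ ∈ closure (f '' D))
    {r : ℝ} (hr : 0 < r) (hr₀ : ENNReal.ofReal r < outerRadius f D y₀) :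
    (μHE[m] : Measure V) (Metric.sphere y₀ r ∩ f '' D) ≠ 0 := by
  refine sphere_inter_image_ne_zero hD hDc.isPreconnected hf
    (finite_fiber_of_multiplicity_lt_top hmult) ?_ ?_
  · obtain ⟨_, ⟨x, hx, rfl⟩, h⟩ := Metric.mem_closure_iff.1 hy₀ r hr
    exact ⟨x, hx, by rwa [dist_comm]⟩
  · obtain ⟨_, ⟨x, hx, rfl⟩, h⟩ : ∃ y ∈ f '' D, ENNReal.ofReal r < edist y y₀ := by
      simpa only [outerRadius, lt_iSup_iff, exists_prop] using hr₀
    exact ⟨x, hx, by rwa [edist_dist, ENNReal.ofReal_lt_ofReal_iff_of_nonneg hr.le] at h⟩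

/-- A family of sets of positive area on spheres with radii in a null set has zero modulus. -/
theorem surfModulus_eq_zero_of_null_radii (hm : m ≠ 0) {p : ℝ} (hp : 0 < p) {y₀ : V} {N : Set ℝ}
    (hN : volume N = 0) {Γ : Set (Set V)}
    (hΓ : ∀ S ∈ Γ, (μHE[m] : Measure V) S ≠ 0 ∧ ∃ r ∈ N, S ⊆ Metric.sphere y₀ r) :
    surfModulus p Γ = 0 := by
  let M := toMeasurable volume N
  have hM : volume M = 0 := by rw [measure_toMeasurable, hN]
  let T : Set V := {y | dist y y₀ ∈ M}
  have hT : MeasurableSet T :=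
    (measurable_id.dist measurable_const) (measurableSet_toMeasurable volume N)
  let ρ : V → ℝ≥0∞ := T.indicator fun _ => ∞
  have hρ : Measurable ρ := measurable_const.indicator hT
  have hadm : ρ ∈ surfAdm Γ := by
    refine ⟨hρ, fun S hS => ?_⟩
    obtain ⟨hpos, r, hr, hSr⟩ := hΓ S hS
    have hST : S ⊆ T := fun y hy => by
      change dist y y₀ ∈ M
      rw [Metric.mem_sphere.1 (hSr hy)]
      exact subset_toMeasurable volume N hr
    have h1 : (fun y => ρ y ^ (m + 1 - 1)) = T.indicator fun _ => ∞ := by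
      ext y
      by_cases hy : y ∈ T <;> simp [ρ, hy, hm]
    rw [h1, lintegral_indicator_const hT, Measure.restrict_apply hT, inter_eq_self_of_subset_right hST,
      Nat.add_sub_cancel, ENNReal.top_mul hpos]
    exact le_top
  refine le_antisymm ((iInf₂_le ρ hadm).trans_eq ?_) bot_le
  have h2 : (fun y => ρ y ^ p) = T.indicator fun _ => ∞ := by
    ext y
    by_cases hy : y ∈ T <;> simp [ρ, hy, hp]
  rw [h2, lintegral_indicator_const hT, volume_preimage_dist_eq_zero y₀ hM, mul_zero]

/-- The core estimate with loss τ: `ρ'` is the m-th root of `ρ` transported with the piecewise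
constant area factors `c k`. -/
theorem exists_extAdm_lintegral_le (hm : m ≠ 0) {p : ℝ} (hp : (m : ℝ) < p) {D : Set V}
    (hDopen : IsOpen D) (hDconn : IsConnected D) {f : V → V} (hfcont : ContinuousOn f D)
    (hfdiff : ∀ᵐ x ∂(volume.restrict D), DifferentiableAt ℝ f x) (hfN : LuzinN f D)
    (hmult : multiplicity f D < ⊤)
    (hJ : volume (f '' {x | x ∈ D ∧ DifferentiableAt ℝ f x ∧ (fderiv ℝ f x).det = 0}) = 0)
    {y₀ : V} (hy₀ : y₀ ∈ closure (f '' D)) {ε : ℝ} (hε : 0 < ε)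
    (hNinv : ∀ᵐ r : ℝ, ε < r → ENNReal.ofReal r < outerRadius f D y₀ →
      LuzinNInvOn f D (Metric.sphere y₀ r ∩ f '' D))
    {ρ : V → ℝ≥0∞} (hρ : ρ ∈ sepAdm (spherePreimages f D y₀ ε)) {τ : ℝ} (hτ : 1 < τ) :
    ∃ ρ' ∈ extAdm p ((fun σ => f '' σ) '' spherePreimages f D y₀ ε),
      ∫⁻ y, ρ' y ^ p / innerDilatationInv (p / (p - m)) f D y ^ ((p - m) / m) ≤
        ENNReal.ofReal τ ^ (p / m) * ∫⁻ x, ρ x ^ (p / m) := by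
  have hm0 : (0 : ℝ) < m := by exact_mod_cast Nat.pos_of_ne_zero hm
  have hp0 : 0 < p := hm0.trans hp
  have hqα : (p / m).HolderConjugate (p / (p - m)) := by
    rw [Real.holderConjugate_iff]
    refine ⟨(one_lt_div hm0).2 hp, ?_⟩
    rw [inv_div, inv_div]
    field_simp
    ring
  obtain ⟨hρm, hρ1⟩ := hρ
  let s : Set V := D ∩ ({x | DifferentiableAt ℝ f x} ∩ {x | (fderiv ℝ f x).det ≠ 0})
  have hs : MeasurableSet s := hDopen.measurableSet.inter
    ((measurableSet_of_differentiableAt ℝ f).inter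
      ((ContinuousLinearMap.continuous_det.measurable.comp (measurable_fderiv ℝ f))
        (measurableSet_singleton 0).compl))
  obtain ⟨P, c, hdisj, hPm, hPs, hPnull, hPinj, hPc, hPW⟩ :=
    exists_regular_pieces hs (fun x hx => hx.2.1) (fun x hx => hx.2.2) hτ
  have hPD : ∀ k, P k ⊆ D := fun k => (hPs k).trans inter_subset_left
  have hPf : ∀ k, ContinuousOn f (P k) := fun k => hfcont.mono (hPD k)
  choose G hGm hG hG0 using fun k => exists_measurable_transfer (hPm k) (hPf k) (hPinj k) hρm
  have hφ : Measurable fun x => ρ x ^ (p / m) * (ENNReal.ofReal |(fderiv ℝ f x).det|)⁻¹ := by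
    have hdm : Measurable fun x => (fderiv ℝ f x).det :=
      ContinuousLinearMap.continuous_det.measurable.comp (measurable_fderiv ℝ f)
    exact (hρm.pow_const _).mul (ENNReal.measurable_ofReal.comp hdm.abs).inv
  choose H hHm hH hH0 using fun k => exists_measurable_transfer (hPm k) (hPf k) (hPinj k) hφ
  let R : V → ℝ≥0∞ := fun y => ∑' k, ENNReal.ofReal (c k) * G k y
  have hR : Measurable R := Measurable.tsum fun k => (hGm k).const_mul _
  let Z : Set V := f '' (D \ ⋃ k, P k)
  have hZ : volume Z = 0 := by
    have hnd : volume {x | x ∈ D ∧ ¬ DifferentiableAt ℝ f x} = 0 := by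
      rw [ae_restrict_iff' hDopen.measurableSet, ae_iff] at hfdiff
      refine measure_mono_null ?_ hfdiff
      exact fun x hx h => hx.2 (h hx.1)
    have h1 := hfN _ (fun x hx => hx.1) hnd
    have h2 := hfN _ (fun x hx => hx.1.1) hPnull
    refine measure_mono_null ?_ (measure_union_null (measure_union_null h1 hJ) h2)
    rintro _ ⟨x, ⟨hxD, hxP⟩, rfl⟩
    by_cases hd : DifferentiableAt ℝ f x
    · by_cases hdet : (fderiv ℝ f x).det = 0
      · exact Or.inl (Or.inr ⟨x, ⟨hxD, hd, hdet⟩, rfl⟩)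
      · exact Or.inr ⟨x, ⟨⟨hxD, hd, hdet⟩, hxP⟩, rfl⟩
    · exact Or.inl (Or.inl ⟨x, ⟨hxD, hd⟩, rfl⟩)
  have hslice : ∀ᵐ r : ℝ, (μHE[m] : Measure V) (Z ∩ (fun y => dist y y₀) ⁻¹' {r}) = 0 := by
    refine ae_euclideanHausdorffMeasure_slice_eq_zero hm ?_ (LipschitzWith.dist_left y₀)
    rwa [EuclideanSpace.euclideanHausdorffMeasure_eq_volume]
  let ρ' : V → ℝ≥0∞ := fun y => R y ^ ((m : ℝ)⁻¹)
  have hρ' : Measurable ρ' := hR.pow_const _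
  have hρ'R : ∀ y, ρ' y ^ (m + 1 - 1) = R y := fun y => by
    rw [Nat.add_sub_cancel, ← ENNReal.rpow_natCast, ← ENNReal.rpow_mul, inv_mul_cancel₀ hm0.ne',
      ENNReal.rpow_one]
  refine ⟨ρ', ⟨hρ'.aemeasurable, ?_⟩, ?_⟩
  -- Radii violating the N⁻¹-property or having a non-null slice of `Z` are null; every surface
  -- failing admissibility has such a radius.
  · have hgood := hNinv.and hslice
    rw [ae_iff] at hgood
    refine surfModulus_eq_zero_of_null_radii hm hp0 (y₀ := y₀) hgood ?_
    rintro S ⟨⟨_, ⟨r, hεr, hr₀, rfl⟩, rfl⟩, hS⟩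
    have hr : 0 < r := hε.trans hεr
    simp only [image_preimage_sphere] at hS ⊢
    refine ⟨sphere_inter_image_pos hDopen hDconn hfcont hmult hy₀ hr hr₀, r, ?_,
      inter_subset_left⟩
    rintro ⟨hNr, hZr⟩
    refine hS ⟨hρ'.aemeasurable, ?_⟩
    simp_rw [hρ'R]
    have hbad : (μHE[m] : Measure V) (D ∩ f ⁻¹' (Z ∩ Metric.sphere y₀ r)) = 0 := by
      refine hNr hεr hr₀ _ ?_ hZr
      rintro _ ⟨⟨x, hx, rfl⟩, hxr⟩
      exact ⟨hxr, x, hx.1, rfl⟩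
    have hpiece : ∀ k, MeasurableSet (P k ∩ f ⁻¹' Metric.sphere y₀ r) ∧
        ∫⁻ x in P k ∩ f ⁻¹' Metric.sphere y₀ r, G k (f x) ∂(μHE[m]) ≤
          ENNReal.ofReal (c k) * ∫⁻ y in Metric.sphere y₀ r ∩ f '' P k, G k y ∂(μHE[m]) :=
      fun k => setLIntegral_comp_le_of_measure_le hDopen hfcont (hPD k) (hPm k)
        Metric.isClosed_sphere (hPW k y₀ r hr) (hGm k)
    have hcov : D ∩ f ⁻¹' (Metric.sphere y₀ r ∩ f '' D) ⊆
        (⋃ k, P k ∩ f ⁻¹' Metric.sphere y₀ r) ∪ D ∩ f ⁻¹' (Z ∩ Metric.sphere y₀ r) := by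
      rintro x ⟨hxD, hxr, -⟩
      by_cases hx : x ∈ ⋃ k, P k
      · obtain ⟨k, hk⟩ := mem_iUnion.1 hx
        exact Or.inl (mem_iUnion.2 ⟨k, hk, hxr⟩)
      · exact Or.inr ⟨hxD, ⟨x, ⟨hxD, hx⟩, rfl⟩, hxr⟩
    calc (1 : ℝ≥0∞)
        ≤ ∫⁻ x in D ∩ f ⁻¹' (Metric.sphere y₀ r ∩ f '' D), ρ x ∂(μHE[m]) :=
          hρ1 _ ⟨r, hεr, hr₀, rfl⟩
      _ ≤ ∫⁻ x in ⋃ k, P k ∩ f ⁻¹' Metric.sphere y₀ r, ρ x ∂(μHE[m]) +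
          ∫⁻ x in D ∩ f ⁻¹' (Z ∩ Metric.sphere y₀ r), ρ x ∂(μHE[m]) :=
          (lintegral_mono_set hcov).trans (lintegral_union_le _ _ _)
      _ ≤ ∑' k, ∫⁻ x in P k ∩ f ⁻¹' Metric.sphere y₀ r, ρ x ∂(μHE[m]) := by
          rw [setLIntegral_measure_zero _ _ hbad, add_zero]
          exact lintegral_iUnion_le _ _
      _ = ∑' k, ∫⁻ x in P k ∩ f ⁻¹' Metric.sphere y₀ r, G k (f x) ∂(μHE[m]) :=
          tsum_congr fun k => setLIntegral_congr_fun (hpiece k).1 fun x hx => (hG k x hx.1).symm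
      _ ≤ ∑' k, ENNReal.ofReal (c k) *
            ∫⁻ y in Metric.sphere y₀ r ∩ f '' D, G k y ∂(μHE[m]) := by
          refine ENNReal.tsum_le_tsum fun k => (hpiece k).2.trans ?_
          gcongr
          exact hPD k
      _ = ∫⁻ y in Metric.sphere y₀ r ∩ f '' D, R y ∂(μHE[m]) := by
          rw [lintegral_tsum fun k => ((hGm k).const_mul _).aemeasurable]
          exact tsum_congr fun k => (lintegral_const_mul _ (hGm k)).symm
  · have hpt : ∀ y, ρ' y ^ p / innerDilatationInv (p / (p - m)) f D y ^ ((p - m) / m) ≤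
        ENNReal.ofReal τ ^ (p / m) * ∑' k, H k y := fun y => by
      refine ENNReal.div_le_of_le_mul ?_
      have h := tsum_transfer_rpow_le hqα (zero_le_one.trans hτ.le) hPD hdisj
        (fun k x hx => (hPs k hx).2.2) hPc hG hG0 hH y
      have he : p / m / (p / (p - m)) = (p - m) / m := by
        have : p - m ≠ 0 := (sub_pos.2 hp).ne'
        field_simp
      rw [he] at h
      have hpow : ρ' y ^ p = R y ^ (p / m) := by
        simp only [ρ']
        rw [← ENNReal.rpow_mul, inv_mul_eq_div]
      rw [hpow]
      exact h
    refine (lintegral_mono hpt).trans ?_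
    rw [lintegral_const_mul _ (Measurable.tsum hHm), lintegral_tsum fun k => (hHm k).aemeasurable]
    gcongr
    calc ∑' k, ∫⁻ y, H k y = ∑' k, ∫⁻ x in P k, ρ x ^ (p / m) :=
          tsum_congr fun k => lintegral_transfer_eq (hPm k) (fun x hx => (hPs k hx).2.1)
            (fun x hx => (hPs k hx).2.2) (hPinj k) (hH k) (hH0 k)
      _ = ∫⁻ x in ⋃ k, P k, ρ x ^ (p / m) := (lintegral_iUnion hPm hdisj _).symm
      _ ≤ ∫⁻ x, ρ x ^ (p / m) := setLIntegral_le_lintegral _ _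

end Modulus

end InverseKI

theorem lemma1 (n : ℕ) (hn : 2 ≤ n) (p : ℝ) (hp : (n : ℝ) - 1 < p)
    (D : Set (InverseKI.E n)) (hDopen : IsOpen D) (hDconn : IsConnected D)
    (f : InverseKI.E n → InverseKI.E n) (hfcont : ContinuousOn f D)
    (hfdiff : ∀ᵐ x ∂(volume.restrict D), DifferentiableAt ℝ f x)
    (hfN : InverseKI.LuzinN f D)
    (hmult : InverseKI.multiplicity f D < ⊤)
    (hJ : volume (f '' {x | x ∈ D ∧ DifferentiableAt ℝ f x ∧ (fderiv ℝ f x).det = 0}) = 0)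
    (y₀ : InverseKI.E n) (hy₀ : y₀ ∈ closure (f '' D))
    (ε : ℝ) (hε : 0 < ε) (hεr₀ : ENNReal.ofReal ε < InverseKI.outerRadius f D y₀)
    (hNinv : ∀ᵐ r : ℝ, ε < r → ENNReal.ofReal r < InverseKI.outerRadius f D y₀ →
      InverseKI.LuzinNInvOn f D (Metric.sphere y₀ r ∩ f '' D)) :
    1 / ((InverseKI.multiplicity f D : ℝ≥0∞) ^ (p / ((n : ℝ) - 1))) *
        (⨅ ρ ∈ InverseKI.extAdm p
            ((fun σ => f '' σ) '' InverseKI.spherePreimages f D y₀ ε),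
          ∫⁻ y in f '' D ∩ InverseKI.ring y₀ ε (InverseKI.outerRadius f D y₀),
            ρ y ^ p /
              InverseKI.innerDilatationInv (p / (p - n + 1)) f D y ^
                ((p - n + 1) / ((n : ℝ) - 1)))
      ≤ InverseKI.sepModulus (p / ((n : ℝ) - 1)) (InverseKI.spherePreimages f D y₀ ε) := by
  obtain ⟨m, rfl⟩ : ∃ m, n = m + 1 := ⟨n - 1, by omega⟩
  have hm : m ≠ 0 := by omega
  have e1 : ((m + 1 : ℕ) : ℝ) - 1 = m := by push_cast; ring
  have e2 : p - ((m + 1 : ℕ) : ℝ) + 1 = p - m := by push_cast; ring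
  rw [e1] at hp
  rw [e1, e2]
  have hm0 : (0 : ℝ) < m := by exact_mod_cast Nat.pos_of_ne_zero hm
  have hmul : (1 : ℝ≥0∞) ≤ (InverseKI.multiplicity f D : ℝ≥0∞) ^ (p / m) := by
    refine ENNReal.one_le_rpow ?_ (div_pos (hm0.trans hp) hm0)
    exact_mod_cast InverseKI.one_le_multiplicity hDconn.nonempty
  -- The multiplicity is at least 1, so the factor is at most 1 and the inequality holds even
  -- without it.
  refine le_trans (mul_le_of_le_one_left bot_le ?_) ?_
  · rw [one_div]
    exact ENNReal.inv_le_one.2 hmul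
  refine le_iInf₂ fun ρ hρ => ?_
  have hlim : Filter.Tendsto (fun τ : ℝ => ENNReal.ofReal τ ^ (p / m) * ∫⁻ x, ρ x ^ (p / m))
      (nhdsWithin 1 (Ioi 1)) (nhds (∫⁻ x, ρ x ^ (p / m))) := by
    have h1 : Filter.Tendsto (fun τ : ℝ => ENNReal.ofReal τ ^ (p / m)) (nhdsWithin 1 (Ioi 1))
        (nhds 1) := by
      have := ((ENNReal.continuous_rpow_const (y := p / m)).comp
        ENNReal.continuous_ofReal).tendsto (1 : ℝ)
      simp only [Function.comp_def, ENNReal.ofReal_one, ENNReal.one_rpow] at this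
      exact this.mono_left nhdsWithin_le_nhds
    simpa using ENNReal.Tendsto.mul_const (b := ∫⁻ x, ρ x ^ (p / m)) h1 (Or.inl one_ne_zero)
  refine ge_of_tendsto hlim ?_
  filter_upwards [self_mem_nhdsWithin] with τ hτ
  obtain ⟨ρ', hρ', hle⟩ := InverseKI.exists_extAdm_lintegral_le hm hp hDopen hDconn hfcont hfdiff
    hfN hmult hJ hy₀ hε hNinv hρ hτ
  exact (iInf₂_le ρ' hρ').trans ((setLIntegral_le_lintegral _ _).trans hle)
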